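/- Let $\mathbb T=\{e^{2\pi i\theta}:\theta\in(-\tfrac12,\tfrac12]\}$ be the unit circle and $m$ the Lebesgue measure on $\mathbb T$ normalized by $m(\mathbb T)=1$. For a finite positive measure $\rho$ on $\mathbb T$ and $n\ge 0$ put $$e_n(\rho)=\inf_{q_0,\dots,q_{n-1}\in\mathbb C}\Bigl(\int_{\mathbb T}\bigl|q_0+q_1t+\dots+q_{n-1}t^{n-1}+t^n\bigr|^2\,d\rho(t)\Bigr)^{1/2}.$$ Theorem (measures with a deep zero at one point). Let $h\colon(0,\tfrac12]\to[0,+\infty)$ be continuous and strictly decreasing with $\int_0^{1/2}h(\theta)\,d\theta=+\infty$, and let $h^{-1}\colon[h(\tfrac12),+\infty)\to(0,\tfrac12]$ be its inverse. Assume that at least one of the following two conditions holds: (i) the function $\theta\mapsto\theta^2h(\theta)$ is non-decreasing on $(0,\tfrac12]$, and $|\log\theta|=O(h(\theta))$ as $\theta\to0^+$; (ii) $\displaystyle\limsup_{a\to\infty}\frac{h^{-1}(a)}{h^{-1}(2a)}<2$. Let $\rho$ be the absolutely continuous measure on $\mathbb T$ with density $\frac{d\rho}{dm}(e^{2\pi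 i\theta})=e^{-h(|\theta|)}$, $0<|\theta|\le\tfrac12$. Then for every integer $n\ge1$ with $n\ge 2h(\tfrac12)$ the equation $n\,h^{-1}(A)=A$ has exactly one solution $A=A(n)\in[h(\tfrac12),+\infty)$, and there are constants $c,C>0$, depending on $h$ but not on $n$, such that for every integer $n\ge1$ for which this equation has a solution $A=A(n)$, $$c\int_0^{1/2}\min(h(\theta),A)\,d\theta\;\le\;|\log e_n(\rho)|\;\le\;C\int_0^{1/2}\min(h(\theta),A)\,d\theta .$$ -/

import Mathlib

open MeasureTheory Set Filter
open scoped Topology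

/-- The quantity `e_n(ρ)`: the infimum over `q₀, …, q_{n-1} ∈ ℂ` of the `L²(ρ)`-norm of
`q₀ + q₁ t + ⋯ + q_{n-1} t^{n-1} + t^n`, where the unit circle is `ℝ / ℤ` and
`t = exp (2 π i x)` for `x ∈ ℝ / ℤ`. -/
noncomputable def szegoError (ρ : Measure UnitAddCircle) (n : ℕ) : ℝ :=
  ⨅ q : Fin n → ℂ,
    Real.sqrt (∫ x : UnitAddCircle,
      ‖(∑ j : Fin n, q j * (AddCircle.toCircle x : ℂ) ^ (j : ℕ)) +
        (AddCircle.toCircle x : ℂ) ^ n‖ ^ 2 ∂ρ)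

/-- The absolutely continuous measure on the circle `ℝ / ℤ` whose density with respect to
Lebesgue measure (of total mass one) at `θ` mod `1`, `|θ| ≤ 1/2`, is `exp (-h (|θ|))`. The norm
of `x : ℝ / ℤ` is the distance to `0`, which is `|θ|` for `x = θ` mod `1`, `|θ| ≤ 1/2`.
(The value at the single point `x = 0` is irrelevant.) -/
noncomputable def deepZeroMeasure (h : ℝ → ℝ) : Measure UnitAddCircle :=
  (volume : Measure UnitAddCircle).withDensity fun x => ENNReal.ofReal (Real.exp (-h ‖x‖))

/-- The inverse `h⁻¹ : h ((0, 1/2]) → (0, 1/2]` of the restriction of `h` to `(0, 1/2]`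
(with unspecified values outside the range `h ((0, 1/2])`). -/
noncomputable def levelInv (h : ℝ → ℝ) : ℝ → ℝ :=
  Function.invFunOn h (Ioc 0 (1 / 2))

/-- `A` is a solution of the equation `n h⁻¹(A) = A`. -/
def IsCutoffLevel (h : ℝ → ℝ) (n : ℕ) (A : ℝ) : Prop :=
  A ∈ h '' Ioc 0 (1 / 2) ∧ (n : ℝ) * levelInv h A = A

/-! Let `θ` be the cutoff angle, `h θ = n * θ = A`, and `H = ∫ min (h, A) = θ A + ∫_θ^{1/2} h`. A
polynomial of degree `n` changes by at most a factor `exp (O(n θ))` over an arc of length of order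
`θ`, so it cannot see `h` above the level `n θ = A`. Hence `-log e_n` should have the size of the
truncated logarithmic integral `H`.

Lower bound for `e_n`. A monic `P` has Mahler measure at least `1`, so the mean of `log |P|²` is
nonnegative. Let `S` be the weighted integral of `|P|²`. On the long arc `|x| ≥ θ`, concavity of the
logarithm bounds the integral of `log |P|²` by `2 ∫_θ^{1/2} h` plus a multiple of `log S`. On the
short arc the Remez type inequality `Polynomial.integral_arc_le` compares `|P|²` with the long arc
at the cost of `exp (O(n θ))`, and the weight costs `exp (h θ)`; averaged over length `2 θ` this
contributes `O(θ A)`. The outcome is `Polynomial.Monic.le_log_integral_deepZeroMeasure`.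

Upper bound for `e_n`. By reflection of roots into the disc, any `p` of degree at most `n` may
compete after division by its Mahler measure (`szegoError_mul_mahlerMeasure_le`). Take `p` whose
modulus is the convolution of `exp g` with a Jackson kernel of degree about `n` concentrated at
scale `θ`. Jensen's inequality for the exponential gives Mahler measure at least `exp (∫ g)`, while
`|p|² exp (-h)` stays bounded when `g` is a suitable minorant
(`szegoError_le_mul_exp_neg_integral`).

The regularity condition serves only to find `g` with `∫ g` comparable to `H` (`exists_minorant`):
under (i) `h` loses at most a factor `4` when the angle doubles, and `g` is a multiple of `min (h,
A)`; under (ii) `H = O(θ A)`, and a constant on one short arc suffices. -/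

/-! ### Distances and integrals on the circle `ℝ / ℤ` -/

/-- The representative of a point of `ℝ / ℤ` closest to `0`. -/
lemma UnitAddCircle.exists_coe_eq (x : UnitAddCircle) :
    ∃ t ∈ Icc (-(1 / 2) : ℝ) (1 / 2), (t : UnitAddCircle) = x ∧ ‖x‖ = |t| := by
  induction x using QuotientAddGroup.induction_on with
  | H y =>
    refine ⟨y - round y, ?_, ?_, UnitAddCircle.norm_eq⟩
    · have := abs_sub_round y
      rw [abs_le] at this
      exact ⟨this.1, this.2⟩
    · rw [AddCircle.coe_sub]
      refine sub_eq_self.2 ((AddCircle.coe_eq_zero_iff 1).2 ⟨round y, by simp⟩)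

lemma UnitAddCircle.norm_coe_of_abs_le {t : ℝ} (ht : |t| ≤ 1 / 2) :
    ‖(t : UnitAddCircle)‖ = |t| :=
  (AddCircle.norm_coe_eq_abs_iff (p := 1) one_ne_zero).2 (by simpa using ht)

lemma UnitAddCircle.norm_le_half (x : UnitAddCircle) : ‖x‖ ≤ 1 / 2 := by
  simpa using AddCircle.norm_le_half_period (p := 1) one_ne_zero (x := x)

lemma UnitAddCircle.coe_toCircle (t : ℝ) :
    ((AddCircle.toCircle (t : UnitAddCircle) : Circle) : ℂ) =
      Complex.exp (2 * Real.pi * t * Complex.I) := by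
  rw [AddCircle.toCircle_apply_mk, Circle.coe_exp]
  push_cast
  simp

lemma UnitAddCircle.norm_toCircle_sub_one (x : UnitAddCircle) :
    ‖((AddCircle.toCircle x : Circle) : ℂ) - 1‖ = 2 * Real.sin (Real.pi * ‖x‖) := by
  obtain ⟨t, ht, rfl, hn⟩ := x.exists_coe_eq
  rw [hn, UnitAddCircle.coe_toCircle]
  have h1 := Complex.norm_exp_I_mul_ofReal_sub_one (x := 2 * Real.pi * t)
  push_cast at h1
  rw [mul_comm _ Complex.I, h1, Real.norm_eq_abs, abs_mul, abs_two]
  congr 1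
  rw [show 2 * Real.pi * t / 2 = Real.pi * t by ring]
  have hπ := Real.pi_pos
  have habs : |t| ≤ 1 / 2 := abs_le.2 ht
  rcases le_total 0 t with h0 | h0
  · rw [abs_of_nonneg h0] at *
    exact abs_of_nonneg (Real.sin_nonneg_of_nonneg_of_le_pi (by positivity) (by nlinarith))
  · rw [abs_of_nonpos h0] at *
    rw [mul_neg, Real.sin_neg]
    exact abs_of_nonpos (Real.sin_nonpos_of_nonpos_of_neg_pi_le (by nlinarith) (by nlinarith))

lemma UnitAddCircle.four_mul_norm_le_norm_toCircle_sub_one (x : UnitAddCircle) :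
    4 * ‖x‖ ≤ ‖((AddCircle.toCircle x : Circle) : ℂ) - 1‖ := by
  rw [UnitAddCircle.norm_toCircle_sub_one]
  have hπ := Real.pi_pos
  have h2 : Real.pi * ‖x‖ ≤ Real.pi / 2 := by nlinarith [x.norm_le_half]
  have := Real.mul_le_sin (x := Real.pi * ‖x‖) (by positivity) h2
  have h3 : 2 / Real.pi * (Real.pi * ‖x‖) = 2 * ‖x‖ := by field_simp
  linarith

lemma UnitAddCircle.norm_toCircle_sub_one_le (x : UnitAddCircle) :
    ‖((AddCircle.toCircle x : Circle) : ℂ) - 1‖ ≤ 2 * Real.pi * ‖x‖ := by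
  rw [UnitAddCircle.norm_toCircle_sub_one]
  have := Real.sin_le (x := Real.pi * ‖x‖) (by positivity)
  linarith

/-- Circle averages over the unit circle are integrals over `ℝ / ℤ`. -/
lemma circleAverage_zero_one_eq_integral (f : ℂ → ℝ) :
    Real.circleAverage f 0 1 = ∫ x : UnitAddCircle, f (AddCircle.toCircle x) := by
  rw [← UnitAddCircle.intervalIntegral_preimage 0, Real.circleAverage_def]
  have h := intervalIntegral.integral_comp_mul_left (a := 0) (b := 0 + 1)
    (fun x => f (circleMap 0 1 x)) (c := 2 * Real.pi) (by positivity)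
  rw [zero_add, mul_one, mul_zero] at h
  rw [zero_add, ← h]
  refine intervalIntegral.integral_congr fun x _ => ?_
  simp only [UnitAddCircle.coe_toCircle, circleMap]
  simp

/-- Integrals over the circle of functions of the distance to `0`. -/
lemma UnitAddCircle.integral_comp_norm (f : ℝ → ℝ)
    (hf : IntervalIntegrable f volume 0 (1 / 2)) :
    ∫ x : UnitAddCircle, f ‖x‖ = 2 * ∫ t in (0 : ℝ)..(1 / 2), f t := by
  rw [← UnitAddCircle.intervalIntegral_preimage (-(1 / 2)),
    show (-(1 / 2) + 1 : ℝ) = 1 / 2 by norm_num]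
  have h1 : ∫ a in (-(1 / 2) : ℝ)..(1 / 2), f ‖(a : UnitAddCircle)‖ =
      ∫ a in (-(1 / 2) : ℝ)..(1 / 2), f |a| := by
    refine intervalIntegral.integral_congr fun x hx => ?_
    rw [uIcc_of_le (by norm_num)] at hx
    rw [UnitAddCircle.norm_coe_of_abs_le (abs_le.2 hx)]
  rw [h1]
  have h2 : ∀ a ∈ uIcc (0 : ℝ) (1 / 2), f |a| = f a := fun a ha => by
    rw [uIcc_of_le (by norm_num)] at ha
    rw [abs_of_nonneg ha.1]
  have h3 : IntervalIntegrable (fun a => f |a|) volume 0 (1 / 2) :=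
    hf.congr fun a ha => by
      rw [uIoc_of_le (by norm_num)] at ha
      simp only [abs_of_pos ha.1]
  have h4 : IntervalIntegrable (fun a => f |a|) volume (-(1 / 2)) 0 := by
    simpa using ((IntervalIntegrable.iff_comp_neg (by finiteness)).1 h3).symm
  rw [← intervalIntegral.integral_add_adjacent_intervals h4 h3,
    intervalIntegral.integral_congr (g := f) (a := 0) (b := 1 / 2) h2]
  have h5 := intervalIntegral.integral_comp_neg (a := 0) (b := 1 / 2) (fun a => f |a|)
  simp only [abs_neg, neg_zero] at h5
  rw [← h5, intervalIntegral.integral_congr (g := f) (a := 0) (b := 1 / 2) h2]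
  ring
-- Mahler measure and the extremal problem
open Polynomial in
/-- Every polynomial agrees in modulus on the unit circle with its Mahler measure times a monic
polynomial of any given larger degree. -/
lemma Polynomial.exists_monic_norm_eval_mul_mahlerMeasure (p : ℂ[X]) :
    ∃ P : ℂ[X], P.Monic ∧ P.natDegree = p.natDegree ∧
      ∀ z : ℂ, ‖z‖ = 1 → p.mahlerMeasure * ‖P.eval z‖ = ‖p.eval z‖ := by
  -- Roots outside the closed disc are reflected in the unit circle; by `hr` each reflection divides
  -- the modulus on the circle by `‖a‖`, the contribution of that root to the Mahler measure.
  let r : ℂ → ℂ := fun a => if ‖a‖ ≤ 1 then a else (starRingEnd ℂ a)⁻¹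
  have hr : ∀ a z : ℂ, ‖z‖ = 1 → max 1 ‖a‖ * ‖z - r a‖ = ‖z - a‖ := by
    intro a z hz
    by_cases ha : ‖a‖ ≤ 1
    · simp [r, ha]
    · push Not at ha
      have ha0 : a ≠ 0 := by
        rintro rfl
        simp at ha
        linarith
      have hzz : z * starRingEnd ℂ z = 1 := by
        rw [Complex.mul_conj, Complex.normSq_eq_norm_sq, hz]
        simp
      simp only [r, not_le.2 ha, if_false]
      rw [max_eq_right ha.le, ← Complex.norm_conj a, ← norm_mul, mul_sub,
        mul_inv_cancel₀ (by simpa using ha0)]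
      calc ‖starRingEnd ℂ a * z - 1‖ = ‖z * starRingEnd ℂ (a - z)‖ := by
            congr 1
            rw [map_sub, mul_sub, hzz, mul_comm]
        _ = ‖z - a‖ := by rw [norm_mul, hz, one_mul, Complex.norm_conj, norm_sub_rev]
  refine ⟨((p.roots.map r).map fun a => X - C a).prod, monic_multisetProd_X_sub_C _, ?_, ?_⟩
  · rw [natDegree_multiset_prod_X_sub_C_eq_card, Multiset.card_map]
    exact splits_iff_card_roots.1 (IsAlgClosed.splits p)
  · intro z hz
    have key : ∀ s : Multiset ℂ, (s.map fun a => max 1 ‖a‖).prod *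
        ‖((((s.map r).map fun a => X - C a).prod).eval z)‖ =
          ‖((s.map fun a => X - C a).prod).eval z‖ := by
      intro s
      induction s using Multiset.induction_on with
      | empty => simp
      | cons a s ih =>
        simp only [Multiset.map_cons, Multiset.prod_cons, eval_mul, norm_mul, eval_sub, eval_X,
          eval_C, ← hr a z hz, ← ih]
        ring
    rw [mahlerMeasure_eq_leadingCoeff_mul_prod_roots, mul_assoc, key, ← norm_mul]
    conv_rhs => rw [(IsAlgClosed.splits p).eq_prod_roots, eval_mul, eval_C]

open Polynomial in
lemma szegoError_nonneg (ρ : Measure UnitAddCircle) (n : ℕ) : 0 ≤ szegoError ρ n :=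
  Real.iInf_nonneg fun _ => Real.sqrt_nonneg _

open Polynomial in
lemma szegoError_le_sqrt_integral (ρ : Measure UnitAddCircle) {P : ℂ[X]} (hP : P.Monic) :
    szegoError ρ P.natDegree ≤
      Real.sqrt (∫ x, ‖P.eval (AddCircle.toCircle x : ℂ)‖ ^ 2 ∂ρ) := by
  refine (ciInf_le ⟨0, ?_⟩ fun j : Fin P.natDegree => P.coeff j).trans_eq ?_
  · rintro _ ⟨q, rfl⟩
    exact Real.sqrt_nonneg _
  · congr 2 with x
    congr 2
    rw [eval_eq_sum_range, Finset.sum_range_succ, hP.coeff_natDegree, one_mul]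
    congr 1
    exact Fin.sum_univ_eq_sum_range (fun j => P.coeff j * (AddCircle.toCircle x : ℂ) ^ j) _

open Polynomial in
lemma le_szegoError {ρ : Measure UnitAddCircle} {n : ℕ} {b : ℝ}
    (h : ∀ P : ℂ[X], P.Monic → P.natDegree = n →
      b ≤ Real.sqrt (∫ x, ‖P.eval (AddCircle.toCircle x : ℂ)‖ ^ 2 ∂ρ)) :
    b ≤ szegoError ρ n := by
  refine le_ciInf fun q => ?_
  have hdeg : (∑ j : Fin n, C (q j) * X ^ (j : ℕ) : ℂ[X]).degree < n := by
    refine (degree_sum_le _ _).trans_lt ((Finset.sup_lt_iff (WithBot.bot_lt_coe n)).2 fun j _ => ?_)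
    exact (degree_C_mul_X_pow_le _ _).trans_lt (WithBot.coe_lt_coe.2 j.2)
  have := h (X ^ n + ∑ j : Fin n, C (q j) * X ^ (j : ℕ)) (monic_X_pow_add hdeg)
    (natDegree_eq_of_degree_eq_some ((degree_add_eq_left_of_degree_lt
      (by rwa [degree_X_pow])).trans (degree_X_pow n)))
  simpa [eval_finsetSum, add_comm] using this

open Polynomial in
-- Multiplication by `X ^ (n - m)` preserves monicity and the modulus on the circle, so every
-- competitor of degree `m` yields one of degree `n`.
lemma szegoError_antitone {ρ : Measure UnitAddCircle} {m n : ℕ} (hmn : m ≤ n) :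
    szegoError ρ n ≤ szegoError ρ m := by
  refine le_szegoError fun P hP hPm => ?_
  have h := szegoError_le_sqrt_integral ρ ((monic_X_pow (R := ℂ) (n - m)).mul hP)
  rw [(monic_X_pow (n - m)).natDegree_mul hP, natDegree_X_pow, hPm, Nat.sub_add_cancel hmn] at h
  simpa only [eval_mul, eval_pow, eval_X, norm_mul, norm_pow, Circle.norm_coe, one_pow,
    one_mul] using h

open Polynomial in
/-- Comparison of the Szegő error with an arbitrary polynomial. -/
lemma szegoError_mul_mahlerMeasure_le (ρ : Measure UnitAddCircle) {n : ℕ} {p : ℂ[X]}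
    (hn : p.natDegree ≤ n) :
    szegoError ρ n * p.mahlerMeasure ≤
      Real.sqrt (∫ x, ‖p.eval (AddCircle.toCircle x : ℂ)‖ ^ 2 ∂ρ) := by
  obtain ⟨P, hP, hd, hz⟩ := p.exists_monic_norm_eval_mul_mahlerMeasure
  have h := (szegoError_antitone hn).trans (hd ▸ szegoError_le_sqrt_integral ρ hP)
  refine (mul_le_mul_of_nonneg_right h p.mahlerMeasure_nonneg).trans_eq ?_
  rw [← Real.sqrt_sq p.mahlerMeasure_nonneg, ← Real.sqrt_mul' _ (sq_nonneg _), mul_comm,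
    ← integral_const_mul]
  simp_rw [← mul_pow, hz _ (Circle.norm_coe _)]

/-! ### A Remez type inequality for a short arc -/

open Polynomial in
/-- The even part of `|P|²` on the unit circle is an algebraic polynomial in the cosine. -/
lemma Polynomial.exists_eval_cos_eq_normSq_add (P : ℂ[X]) {n : ℕ} (hP : P.natDegree ≤ n) :
    ∃ p : ℝ[X], p.natDegree ≤ n ∧ ∀ φ : ℝ, p.eval (Real.cos φ) =
      ‖P.eval (Complex.exp (φ * Complex.I))‖ ^ 2 +
        ‖P.eval (Complex.exp (-φ * Complex.I))‖ ^ 2 := by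
  -- `|P|²` is a double sum of terms `c exp (i (j - l) φ)`; adding the value at `-φ` leaves the real
  -- part `2 Re c cos ((j - l) φ)`. The integer index `j - l` may be negative, and `T` then has
  -- degree `|j - l| ≤ n`.
  refine ⟨∑ j ∈ Finset.range (n + 1), ∑ l ∈ Finset.range (n + 1),
    C (2 * (P.coeff j * starRingEnd ℂ (P.coeff l)).re) * Chebyshev.T ℝ ((j : ℤ) - l), ?_, ?_⟩
  · refine natDegree_sum_le_of_forall_le _ _ fun j hj =>
      natDegree_sum_le_of_forall_le _ _ fun l hl => (natDegree_C_mul_le _ _).trans ?_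
    rw [Chebyshev.natDegree_T]
    simp only [Finset.mem_range] at hj hl
    omega
  · have key : ∀ φ : ℝ, ‖P.eval (Complex.exp (φ * Complex.I))‖ ^ 2 =
        ∑ j ∈ Finset.range (n + 1), ∑ l ∈ Finset.range (n + 1),
          (P.coeff j * starRingEnd ℂ (P.coeff l) *
            Complex.exp (((j : ℝ) - l) * φ * Complex.I)).re := by
      intro φ
      rw [← Complex.normSq_eq_norm_sq, ← Complex.ofReal_re (Complex.normSq _), ← Complex.mul_conj,
        eval_eq_sum_range' (Nat.lt_succ_of_le hP), map_sum, Finset.sum_mul_sum, Complex.re_sum]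
      refine Finset.sum_congr rfl fun j _ => ?_
      rw [Complex.re_sum]
      refine Finset.sum_congr rfl fun l _ => ?_
      rw [map_mul, map_pow, ← Complex.exp_conj, ← Complex.exp_nat_mul, ← Complex.exp_nat_mul,
        mul_mul_mul_comm, ← Complex.exp_add]
      congr 3
      simp
      ring
    intro φ
    have key' := key (-φ)
    rw [Complex.ofReal_neg] at key'
    rw [key, key', ← Finset.sum_add_distrib, eval_finsetSum]
    refine Finset.sum_congr rfl fun j _ => ?_
    rw [← Finset.sum_add_distrib, eval_finsetSum]
    refine Finset.sum_congr rfl fun l _ => ?_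
    have e1 : ((j : ℝ) - l : ℂ) * φ * Complex.I = (((j : ℝ) - l) * φ : ℝ) * Complex.I := by
      push_cast; ring
    have e2 : ((j : ℝ) - l : ℂ) * -φ * Complex.I = (-(((j : ℝ) - l) * φ) : ℝ) * Complex.I := by
      push_cast; ring
    generalize P.coeff j * starRingEnd ℂ (P.coeff l) = c
    rw [eval_mul, eval_C, Chebyshev.T_real_cos, e1, e2, Complex.mul_re c, Complex.mul_re c,
      Complex.exp_ofReal_mul_I_re, Complex.exp_ofReal_mul_I_re, Complex.exp_ofReal_mul_I_im,
      Complex.exp_ofReal_mul_I_im, Real.cos_neg, Real.sin_neg]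
    push_cast
    ring

open Polynomial in
/-- Growth of a real polynomial outside an interval on which it is bounded. -/
lemma Polynomial.eval_one_le_of_forall_abs_le {p : ℝ[X]} {N : ℕ} (hp : p.natDegree ≤ N) {β M : ℝ}
    (hβ : 0 ≤ β) (hβ' : β < Real.pi) (hM : 0 ≤ M)
    (h : ∀ x ∈ Icc (-1) (Real.cos β), |p.eval x| ≤ M) :
    p.eval 1 ≤ M * Real.exp (2 * N * Real.tan (β / 2)) := by
  wlog hM' : 0 < M generalizing M
  · refine le_of_forall_pos_le_add fun ε hε => ?_
    have hE := Real.exp_pos (2 * N * Real.tan (β / 2))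
    have hε' : 0 < ε / Real.exp (2 * N * Real.tan (β / 2)) := by positivity
    refine (this (M := M + ε / Real.exp (2 * N * Real.tan (β / 2))) (by positivity)
      (fun x hx => (h x hx).trans (by linarith)) (by positivity)).trans_eq ?_
    field_simp
  replace hM := hM'
  set τ := Real.tan (β / 2) with hτ
  set x₀ := Real.cos β with hx₀
  have hτ0 : 0 ≤ τ := Real.tan_nonneg_of_nonneg_of_le_pi_div_two (by linarith) (by linarith)
  have hc : 0 < Real.cos (β / 2) := Real.cos_pos_of_mem_Ioo ⟨by linarith, by linarith⟩
  have hx1 : 1 + x₀ = 2 * Real.cos (β / 2) ^ 2 := by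
    rw [hx₀, Real.cos_sq]; ring_nf
  have hx2 : (1 + 2 * τ ^ 2) * (1 + x₀) = 3 - x₀ := by
    rw [hτ, Real.tan_eq_sin_div_cos, hx1]
    field_simp
    rw [Real.sin_sq]
    linarith
  have hx0 : x₀ ≤ 1 := Real.cos_le_one _
  -- The affine map sends `[-1, 1]` onto `[-1, x₀]` and the point `1 + 2 τ ^ 2` to `1`, so the
  -- extremal growth of Chebyshev polynomials outside `[-1, 1]` applies. With `sinh u = τ` the bound
  -- is `T_N (cosh (2 u)) = cosh (2 N u)`, and `u ≤ τ`.
  set r : ℝ[X] := C M⁻¹ * p.comp (C ((1 + x₀) / 2) * X + C ((x₀ - 1) / 2)) with hr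
  have hre : ∀ y, r.eval y = M⁻¹ * p.eval ((1 + x₀) / 2 * y + (x₀ - 1) / 2) := by
    intro y; simp [hr]
  have hdeg : r.natDegree ≤ N := by
    refine (natDegree_C_mul_le _ _).trans (natDegree_comp_le.trans ?_)
    calc _ ≤ p.natDegree * 1 := by gcongr; exact natDegree_linear_le
      _ ≤ N := by simpa using hp
  have hbd : ∀ y ∈ Icc (-1 : ℝ) 1, |r.eval y| ≤ 1 := by
    intro y hy
    rw [hre, abs_mul, abs_of_pos (inv_pos.2 hM), inv_mul_le_one₀ hM]
    have : 0 < 1 + x₀ := by rw [hx1]; positivity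
    exact h _ ⟨by nlinarith [hy.1], by nlinarith [hy.2]⟩
  have hY : (1 : ℝ) ≤ 1 + 2 * τ ^ 2 := by nlinarith
  have hT := Chebyshev.eval_iterate_derivative_le_of_forall_abs_le_one (k := 0) hY
    (natDegree_le_iff_degree_le.1 hdeg) hbd
  simp only [Function.iterate_zero, id_eq, hre] at hT
  rw [show (1 + x₀) / 2 * (1 + 2 * τ ^ 2) + (x₀ - 1) / 2 = 1 by linarith] at hT
  set u := Real.arsinh τ with hu
  have hsu : Real.sinh u = τ := Real.sinh_arsinh τ
  have hu0 : 0 ≤ u := Real.arsinh_nonneg_iff.2 hτ0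
  have huτ : u ≤ τ := hsu ▸ Real.self_le_sinh_iff.2 hu0
  have hcosh : 1 + 2 * τ ^ 2 = Real.cosh (2 * u) := by
    rw [Real.cosh_two_mul, Real.cosh_sq, hsu]; ring
  rw [hcosh, Chebyshev.T_real_cosh] at hT
  have h1 : Real.cosh ((N : ℤ) * (2 * u)) ≤ Real.exp (2 * N * τ) := by
    rw [Real.cosh_eq]
    have a1 : Real.exp (((N : ℤ) : ℝ) * (2 * u)) ≤ Real.exp (2 * N * τ) := by
      apply Real.exp_le_exp.2
      push_cast
      nlinarith [mul_le_mul_of_nonneg_left huτ (Nat.cast_nonneg (α := ℝ) N)]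
    have a2 : Real.exp (-(((N : ℤ) : ℝ) * (2 * u))) ≤ Real.exp (2 * N * τ) := by
      apply Real.exp_le_exp.2
      push_cast
      nlinarith [mul_nonneg (Nat.cast_nonneg (α := ℝ) N) hu0,
        mul_nonneg (Nat.cast_nonneg (α := ℝ) N) hτ0]
    linarith
  rw [← inv_mul_le_iff₀ hM]
  exact hT.trans h1

open Polynomial in
-- An antiderivative of a nonnegative polynomial is monotone, so its supremum over an interval is
-- attained at the right end, where it is an integral. This converts the uniform growth estimate
-- into an estimate of integrals.
lemma Polynomial.exists_derivative_eq (p : ℝ[X]) (a : ℝ) :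
    ∃ q : ℝ[X], q.derivative = p ∧ q.natDegree ≤ p.natDegree + 1 ∧ q.eval a = 0 := by
  set q : ℝ[X] := ∑ k ∈ Finset.range (p.natDegree + 1),
    C (p.coeff k / (k + 1)) * X ^ (k + 1) with hq
  have hq' : q.natDegree ≤ p.natDegree + 1 := by
    refine natDegree_sum_le_of_forall_le _ _ fun k hk => (natDegree_C_mul_X_pow_le _ _).trans ?_
    simp only [Finset.mem_range] at hk
    omega
  refine ⟨q - C (q.eval a), ?_, ?_, by simp⟩
  · rw [derivative_sub, derivative_C, sub_zero, hq, derivative_sum]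
    conv_rhs => rw [p.as_sum_range_C_mul_X_pow]
    refine Finset.sum_congr rfl fun k _ => ?_
    rw [derivative_C_mul_X_pow]
    congr 2
    push_cast
    field_simp
  · rwa [natDegree_sub_C]

open Polynomial in
/-- A Remez type inequality in `L²` for a small arc. -/
lemma Polynomial.integral_arc_le (P : ℂ[X]) {n : ℕ} (hP : P.natDegree ≤ n) {θ : ℝ} (hθ : 0 < θ)
    (hθ' : θ ≤ 1 / 12) :
    ∫ x in (-θ)..θ, ‖P.eval (Complex.exp (2 * Real.pi * x * Complex.I))‖ ^ 2 ≤
      Real.exp (2 * (n + 1) * Real.tan (3 * Real.pi * θ)) / (4 * θ) *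
        ∫ x in θ..(1 - θ), ‖P.eval (Complex.exp (2 * Real.pi * x * Complex.I))‖ ^ 2 := by
  have hπ := Real.pi_pos
  set T : ℝ → ℝ := fun x => ‖P.eval (Complex.exp (2 * Real.pi * x * Complex.I))‖ ^ 2 with hT
  have hTc : Continuous T := by
    refine (P.continuous.comp (Complex.continuous_exp.comp ?_)).norm.pow 2
    fun_prop
  have hT0 : ∀ x, 0 ≤ T x := fun x => by positivity
  have hTp : ∀ x, T (x + 1) = T x := fun x => by
    simp only [hT]
    congr 3
    rw [Complex.exp_eq_exp_iff_exists_int]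
    exact ⟨1, by push_cast; ring⟩
  -- Symmetrization is about `-2 θ` rather than `0`: the short arc then corresponds to `φ ∈ [θ, 3
  -- θ]`, where the Jacobian `sin (2 π φ)` of the substitution by the cosine is at least `4 θ`. The
  -- condition `θ ≤ 1 / 12` keeps `2 π φ ≤ π / 2`.
  obtain ⟨p, hpn, hp⟩ := (P.comp (C (Complex.exp (2 * Real.pi * (-2 * θ : ℝ) * Complex.I)) *
    X)).exists_eval_cos_eq_normSq_add (n := n) (natDegree_comp_le.trans (by
      calc _ ≤ P.natDegree * 1 := by
            gcongr
            exact (natDegree_C_mul_le _ _).trans natDegree_X_le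
        _ ≤ n := by simpa using hP))
  set G : ℝ → ℝ := fun φ => T (-2 * θ + φ) + T (-2 * θ - φ) with hG
  have hGc : Continuous G := by fun_prop
  have hG0 : ∀ x, 0 ≤ G x := fun x => add_nonneg (hT0 _) (hT0 _)
  have hpG : ∀ φ, p.eval (Real.cos (2 * Real.pi * φ)) = G φ := by
    intro φ
    rw [hp]
    simp only [hG, hT, eval_comp, eval_mul, eval_C, eval_X, ← Complex.exp_add]
    congr 4 <;> congr 1 <;> push_cast <;> ring
  have hp0 : ∀ x ∈ Icc (-1 : ℝ) 1, 0 ≤ p.eval x := by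
    intro x hx
    have := hpG (Real.arccos x / (2 * Real.pi))
    rw [mul_div_cancel₀ _ (by positivity), Real.cos_arccos hx.1 hx.2] at this
    rw [this]
    exact hG0 _
  obtain ⟨q, hqp, hqn, hq1⟩ := p.exists_derivative_eq (-1)
  have hqmono : MonotoneOn (fun x => q.eval x) (Icc (-1) 1) := by
    refine monotoneOn_of_deriv_nonneg (convex_Icc _ _) q.continuous.continuousOn
      q.differentiable.differentiableOn fun x hx => ?_
    rw [Polynomial.deriv, hqp]
    exact hp0 x (interior_subset hx)
  have hcosmem : ∀ x, Real.cos x ∈ Icc (-1 : ℝ) 1 := Real.cos_mem_Icc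
  have hF : ∀ a b, ∫ φ in a..b, G φ * Real.sin (2 * Real.pi * φ) =
      (q.eval (Real.cos (2 * Real.pi * a)) - q.eval (Real.cos (2 * Real.pi * b))) /
        (2 * Real.pi) := by
    intro a b
    have hd : ∀ φ ∈ uIcc a b, HasDerivAt
        (fun φ => -(q.eval (Real.cos (2 * Real.pi * φ)) / (2 * Real.pi)))
        (G φ * Real.sin (2 * Real.pi * φ)) φ := by
      intro φ _
      have h1 := (q.hasDerivAt (Real.cos (2 * Real.pi * φ))).comp φ
        (((hasDerivAt_id φ).const_mul (2 * Real.pi)).cos)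
      convert! (h1.div_const (2 * Real.pi)).neg using 1
      rw [hqp, id, hpG]
      field_simp
    rw [intervalIntegral.integral_eq_sub_of_hasDerivAt hd
      (Continuous.intervalIntegrable (by fun_prop) _ _)]
    ring
  have hqnn : ∀ x ∈ Icc (-1 : ℝ) 1, 0 ≤ q.eval x := fun x hx => by
    have := hqmono (left_mem_Icc.2 (by norm_num)) hx hx.1
    simpa only [hq1] using this
  set x₀ := Real.cos (6 * Real.pi * θ) with hx₀
  have hgrow : q.eval 1 ≤ q.eval x₀ * Real.exp (2 * (n + 1) * Real.tan (3 * Real.pi * θ)) := by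
    have := q.eval_one_le_of_forall_abs_le (N := n + 1) (β := 6 * Real.pi * θ) (M := q.eval x₀)
      (hqn.trans (by omega)) (by positivity) (by nlinarith) (hqnn _ (hcosmem _))
      fun x hx => by
        have hx' : x ∈ Icc (-1 : ℝ) 1 := ⟨hx.1, hx.2.trans (Real.cos_le_one _)⟩
        rw [abs_of_nonneg (hqnn x hx')]
        exact hqmono hx' (hcosmem _) hx.2
    rw [show 6 * Real.pi * θ / 2 = 3 * Real.pi * θ by ring] at this
    exact_mod_cast this
  have h1 : ∫ x in (-θ)..θ, T x ≤ ∫ φ in θ..(3 * θ), G φ := by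
    have := intervalIntegral.integral_comp_add_left (a := θ) (b := 3 * θ) T (-2 * θ)
    rw [show -2 * θ + θ = -θ by ring, show -2 * θ + 3 * θ = θ by ring] at this
    rw [← this]
    refine intervalIntegral.integral_mono (by linarith)
      (Continuous.intervalIntegrable (by fun_prop) _ _) (hGc.intervalIntegrable _ _) fun x => ?_
    have := hT0 (-2 * θ - x)
    simp only [hG]
    linarith
  have h2 : 4 * θ * ∫ φ in θ..(3 * θ), G φ ≤ q.eval 1 / (2 * Real.pi) := by
    calc 4 * θ * ∫ φ in θ..(3 * θ), G φ = ∫ φ in θ..(3 * θ), 4 * θ * G φ :=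
          (intervalIntegral.integral_const_mul _ _).symm
      _ ≤ ∫ φ in θ..(3 * θ), G φ * Real.sin (2 * Real.pi * φ) := by
          refine intervalIntegral.integral_mono_on (by linarith)
            (Continuous.intervalIntegrable (by fun_prop) _ _)
            (Continuous.intervalIntegrable (by fun_prop) _ _) fun x hx => ?_
          rw [mul_comm]
          refine mul_le_mul_of_nonneg_left ?_ (hG0 x)
          have hx0 := hθ.trans_le hx.1
          have h3 := Real.mul_le_sin (x := 2 * Real.pi * x) (by positivity)
            (by nlinarith [hx.2])
          rw [show 2 / Real.pi * (2 * Real.pi * x) = 4 * x by field_simp; ring] at h3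
          linarith [hx.1]
      _ ≤ q.eval 1 / (2 * Real.pi) := by
          rw [hF]
          gcongr
          have h3 := hqmono (hcosmem (2 * Real.pi * θ)) (right_mem_Icc.2 (by norm_num))
            (Real.cos_le_one _)
          have h4 := hqnn _ (hcosmem (2 * Real.pi * (3 * θ)))
          simp only at h3
          linarith
  have h5 : q.eval x₀ / (2 * Real.pi) ≤ ∫ φ in (3 * θ)..(1 / 2), G φ := by
    have h3 := hF (3 * θ) (1 / 2)
    rw [show 2 * Real.pi * (1 / 2) = Real.pi by ring, Real.cos_pi, hq1, sub_zero,
      show 2 * Real.pi * (3 * θ) = 6 * Real.pi * θ by ring] at h3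
    rw [hx₀, ← h3]
    refine intervalIntegral.integral_mono_on (by linarith)
      (Continuous.intervalIntegrable (by fun_prop) _ _) (hGc.intervalIntegrable _ _)
      fun x hx => ?_
    exact mul_le_of_le_one_right (hG0 x) (Real.sin_le_one _)
  -- The two summands of `G` cover the adjacent intervals `[θ, 1/2 - 2 θ]` and, after a shift by the
  -- period, `[1/2 - 2 θ, 1 - 5 θ]`, both inside the long arc.
  have h6 : ∫ φ in (3 * θ)..(1 / 2), G φ ≤ ∫ x in θ..(1 - θ), T x := by
    have e1 := intervalIntegral.integral_comp_add_left (a := 3 * θ) (b := 1 / 2) T (-2 * θ)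
    have e2 := intervalIntegral.integral_comp_sub_left (a := 3 * θ) (b := 1 / 2) T (1 - 2 * θ)
    have e3 : (fun φ => T (-2 * θ - φ)) = fun φ => T (1 - 2 * θ - φ) := by
      ext φ
      rw [← hTp]
      congr 1
      ring
    have hi : ∀ a b, IntervalIntegrable T volume a b := fun a b => hTc.intervalIntegrable a b
    simp only [hG]
    rw [intervalIntegral.integral_add (Continuous.intervalIntegrable (by fun_prop) _ _)
      (Continuous.intervalIntegrable (by fun_prop) _ _), e3, e1, e2,
      show -2 * θ + 1 / 2 = 1 - 2 * θ - 1 / 2 by ring,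
      intervalIntegral.integral_add_adjacent_intervals (hi _ _) (hi _ _)]
    exact intervalIntegral.integral_mono_interval (by linarith) (by linarith) (by linarith)
      (ae_of_all _ hT0) (hi _ _)
  rw [div_mul_eq_mul_div, le_div_iff₀ (by positivity), mul_comm]
  calc 4 * θ * ∫ x in (-θ)..θ, T x ≤ 4 * θ * ∫ φ in θ..(3 * θ), G φ := by gcongr
    _ ≤ q.eval 1 / (2 * Real.pi) := h2
    _ ≤ q.eval x₀ * Real.exp (2 * (n + 1) * Real.tan (3 * Real.pi * θ)) / (2 * Real.pi) := by
        gcongr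
    _ = Real.exp (2 * (n + 1) * Real.tan (3 * Real.pi * θ)) * (q.eval x₀ / (2 * Real.pi)) := by
        ring
    _ ≤ _ := by
        gcongr
        exact h5.trans h6

/-! ### Jensen's inequality and integration against the weight -/

/-- Jensen's inequality for the logarithm. -/
lemma integral_log_le_mul_log {α : Type*} [MeasurableSpace α] {μ : Measure α} [IsFiniteMeasure μ]
    [NeZero μ] {u : α → ℝ} (hu : ∀ᵐ x ∂μ, 0 < u x) (hui : Integrable u μ)
    (hl : Integrable (fun x => Real.log (u x)) μ) :
    0 < ∫ x, u x ∂μ ∧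
      ∫ x, Real.log (u x) ∂μ ≤ μ.real univ * Real.log ((∫ x, u x ∂μ) / μ.real univ) := by
  have hm : 0 < μ.real univ := by
    rw [measureReal_def, ENNReal.toReal_pos_iff]
    exact ⟨(NeZero.ne (μ univ)).bot_lt, measure_lt_top _ _⟩
  have hpos : 0 < ∫ x, u x ∂μ := by
    rw [integral_pos_iff_support_of_nonneg_ae (hu.mono fun x hx => hx.le) hui]
    have : Function.support u =ᵐ[μ] univ := by
      filter_upwards [hu] with x hx
      exact eq_true (hx.ne')
    rw [measure_congr this]
    exact (NeZero.ne (μ univ)).bot_lt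
  refine ⟨hpos, ?_⟩
  set c := (∫ x, u x ∂μ) / μ.real univ with hc
  have hc0 : 0 < c := by positivity
  -- The logarithm lies below its tangent at the mean `c`.
  calc ∫ x, Real.log (u x) ∂μ ≤ ∫ x, (u x / c + (Real.log c - 1)) ∂μ := by
        refine integral_mono_ae hl ((hui.div_const c).add (integrable_const _)) ?_
        filter_upwards [hu] with x hx
        have := Real.log_le_sub_one_of_pos (div_pos hx hc0)
        rw [Real.log_div hx.ne' hc0.ne'] at this
        linarith
    _ = μ.real univ * Real.log c := by
        rw [integral_add (hui.div_const c) (integrable_const _), integral_div, integral_const,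
          smul_eq_mul, hc]
        field_simp
        ring

instance UnitAddCircle.instNullSingletonClassVolume :
    NullSingletonClass (volume : Measure UnitAddCircle) where
  measure_singleton x := by
    have := AddCircle.volume_closedBall (1 : ℝ) (x := x) 0
    simpa using this

lemma UnitAddCircle.ae_ne_zero : ∀ᵐ x : UnitAddCircle, x ≠ 0 := by
  simp [ae_iff]

lemma UnitAddCircle.ae_norm_mem_Ioc : ∀ᵐ x : UnitAddCircle, ‖x‖ ∈ Ioc (0 : ℝ) (1 / 2) := by
  filter_upwards [UnitAddCircle.ae_ne_zero] with x hx
  exact ⟨norm_pos_iff.2 hx, x.norm_le_half⟩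

lemma UnitAddCircle.aemeasurable_comp_norm {f : ℝ → ℝ} (hf : ContinuousOn f (Ioc 0 (1 / 2))) :
    AEMeasurable (fun x : UnitAddCircle => f ‖x‖) := by
  have h1 : ContinuousOn (fun x : UnitAddCircle => f ‖x‖) {0}ᶜ :=
    hf.comp continuous_norm.continuousOn fun x hx => ⟨norm_pos_iff.2 hx, x.norm_le_half⟩
  have h2 := h1.aemeasurable (μ := volume) (measurableSet_singleton 0).compl
  rwa [Measure.restrict_eq_self_of_ae_mem (s := {0}ᶜ) UnitAddCircle.ae_ne_zero] at h2

lemma integral_deepZeroMeasure {h : ℝ → ℝ} (h_cont : ContinuousOn h (Ioc 0 (1 / 2)))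
    (f : UnitAddCircle → ℝ) :
    ∫ x, f x ∂deepZeroMeasure h = ∫ x, Real.exp (-h ‖x‖) * f x := by
  have hm : AEMeasurable (fun x : UnitAddCircle => ENNReal.ofReal (Real.exp (-h ‖x‖))) :=
    (Real.measurable_exp.comp_aemeasurable
      (UnitAddCircle.aemeasurable_comp_norm h_cont).neg).ennreal_ofReal
  rw [deepZeroMeasure, integral_withDensity_eq_integral_toReal_smul₀ hm
    (ae_of_all _ fun _ => ENNReal.ofReal_lt_top)]
  simp only [ENNReal.toReal_ofReal (Real.exp_pos _).le, smul_eq_mul]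

lemma integrable_exp_neg_mul {h : ℝ → ℝ} (h_nonneg : ∀ θ ∈ Ioc (0 : ℝ) (1 / 2), 0 ≤ h θ)
    (h_cont : ContinuousOn h (Ioc 0 (1 / 2))) {f : UnitAddCircle → ℝ} (hf : Continuous f) :
    Integrable fun x : UnitAddCircle => Real.exp (-h ‖x‖) * f x := by
  refine (hf.integrable_of_hasCompactSupport (HasCompactSupport.of_compactSpace f)).bdd_mul
    (c := 1) (Real.measurable_exp.comp_aemeasurable
      (UnitAddCircle.aemeasurable_comp_norm h_cont).neg).aestronglyMeasurable ?_
  filter_upwards [UnitAddCircle.ae_norm_mem_Ioc] with x hx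
  rw [Real.norm_eq_abs, Real.abs_exp, Real.exp_le_one_iff]
  linarith [h_nonneg _ hx]

open Polynomial in
lemma Polynomial.continuous_norm_sq_eval_toCircle (P : ℂ[X]) :
    Continuous fun x : UnitAddCircle => ‖P.eval (AddCircle.toCircle x : ℂ)‖ ^ 2 :=
  (P.continuous.comp (continuous_subtype_val.comp AddCircle.continuous_toCircle)).norm.pow 2

open Polynomial in
lemma Polynomial.ae_eval_toCircle_ne_zero {P : ℂ[X]} (hP : P ≠ 0) :
    ∀ᵐ x : UnitAddCircle, P.eval (AddCircle.toCircle x : ℂ) ≠ 0 := by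
  rw [ae_iff]
  refine Set.Finite.measure_zero ?_ _
  have : {x : UnitAddCircle | ¬ P.eval (AddCircle.toCircle x : ℂ) ≠ 0} =
      (fun x : UnitAddCircle => (AddCircle.toCircle x : ℂ)) ⁻¹' (P.roots.toFinset : Set ℂ) := by
    ext x
    simp [hP]
  rw [this]
  exact P.roots.toFinset.finite_toSet.preimage
    (Subtype.val_injective.comp (AddCircle.injective_toCircle one_ne_zero)).injOn

open Polynomial in
lemma Polynomial.integrable_log_norm_eval_toCircle (P : ℂ[X]) :
    Integrable fun x : UnitAddCircle => Real.log ‖P.eval (AddCircle.toCircle x : ℂ)‖ := by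
  have h1 : IntervalIntegrable (fun x : ℝ => Real.log ‖P.eval (circleMap 0 1 (2 * Real.pi * x))‖)
      volume 0 1 := by
    have := (intervalIntegrable_mahlerMeasure P).comp_mul_left (c := 2 * Real.pi)
    rwa [zero_div, div_self (by positivity)] at this
  rw [intervalIntegrable_iff_integrableOn_Ioc_of_le zero_le_one] at h1
  have h2 := UnitAddCircle.measurePreserving_mk 0
  rw [zero_add] at h2
  have hm : AEStronglyMeasurable
      (fun x : UnitAddCircle => Real.log ‖P.eval (AddCircle.toCircle x : ℂ)‖) volume :=
    (Real.measurable_log.comp (P.continuous.comp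
      (continuous_subtype_val.comp
        AddCircle.continuous_toCircle)).norm.measurable).aestronglyMeasurable
  rw [← h2.integrable_comp hm]
  refine h1.congr (ae_of_all _ fun x => ?_)
  simp only [Function.comp]
  have := UnitAddCircle.coe_toCircle x
  simp only [circleMap]
  rw [this]
  simp

lemma UnitAddCircle.intervalIntegrable_coe {F : UnitAddCircle → ℝ} (hF : Integrable F) (t : ℝ) :
    IntervalIntegrable (fun x : ℝ => F x) volume t (t + 1) := by
  rw [intervalIntegrable_iff_integrableOn_Ioc_of_le (by linarith)]
  exact (UnitAddCircle.measurePreserving_mk t).integrable_comp_of_integrable hF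

lemma UnitAddCircle.ae_coe {p : UnitAddCircle → Prop} (hp : ∀ᵐ x, p x) (t : ℝ) :
    ∀ᵐ x : ℝ ∂volume.restrict (Ioc t (t + 1)), p x :=
  (UnitAddCircle.measurePreserving_mk t).quasiMeasurePreserving.ae hp

/-- Jensen's inequality for the logarithm on an interval. -/
lemma intervalIntegral_log_le_mul_log {u : ℝ → ℝ} {a b : ℝ} (hab : a < b)
    (hu : ∀ᵐ x ∂volume.restrict (Ioc a b), 0 < u x) (hui : IntervalIntegrable u volume a b)
    (hl : IntervalIntegrable (fun x => Real.log (u x)) volume a b) :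
    0 < ∫ x in a..b, u x ∧
      ∫ x in a..b, Real.log (u x) ≤ (b - a) * Real.log ((∫ x in a..b, u x) / (b - a)) := by
  have : NeZero (volume.restrict (Ioc a b)) := ⟨by simp [hab]⟩
  rw [intervalIntegrable_iff_integrableOn_Ioc_of_le hab.le] at hui hl
  have hm : (volume.restrict (Ioc a b)).real univ = b - a := by
    simp [measureReal_def, hab.le]
  rw [intervalIntegral.integral_of_le hab.le, intervalIntegral.integral_of_le hab.le, ← hm]
  exact integral_log_le_mul_log hu hui hl

lemma Real.neg_mul_log_le_one {x : ℝ} (hx : 0 < x) : -(x * Real.log x) ≤ 1 := by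
  have h := Real.log_le_sub_one_of_pos (inv_pos.2 hx)
  rw [Real.log_inv] at h
  have h2 := mul_le_mul_of_nonneg_left h hx.le
  rw [mul_sub, mul_inv_cancel₀ hx.ne'] at h2
  linarith

lemma Real.tan_le_two_mul {x : ℝ} (hx : 0 ≤ x) (hx1 : x ≤ 1) : Real.tan x ≤ 2 * x := by
  have hc : 1 / 2 ≤ Real.cos x := by
    have := Real.one_sub_sq_div_two_le_cos (x := x)
    nlinarith
  rw [Real.tan_eq_sin_div_cos, div_le_iff₀ (by linarith)]
  nlinarith [Real.sin_le hx]

/-! ### Lower bound for the weighted norm of a monic polynomial -/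

open Polynomial in
/-- Lower bound for the weighted norm of a monic polynomial: if `h ≤ A` outside of the arc of
half-length `θ` and the degree is `n`, then the logarithm of the squared norm is bounded from below
in terms of `n θ²`, `A θ` and the integral of `h` outside the arc. -/
lemma Polynomial.Monic.le_log_integral_deepZeroMeasure {h : ℝ → ℝ}
    (h_nonneg : ∀ θ ∈ Ioc (0 : ℝ) (1 / 2), 0 ≤ h θ)
    (h_cont : ContinuousOn h (Ioc 0 (1 / 2))) (h_anti : StrictAntiOn h (Ioc 0 (1 / 2)))
    {P : ℂ[X]} (hP : P.Monic) {n : ℕ} (hPn : P.natDegree = n) (hn : 1 ≤ n) {θ : ℝ} (hθ : 0 < θ)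
    (hθ' : θ ≤ 1 / 12) :
    0 < ∫ x, ‖P.eval (AddCircle.toCircle x : ℂ)‖ ^ 2 ∂deepZeroMeasure h ∧
    -(160 * n * θ ^ 2 + 2 * θ * h θ + 2 * (∫ x in θ..(1 / 2), h x) + 5) ≤
      Real.log (∫ x, ‖P.eval (AddCircle.toCircle x : ℂ)‖ ^ 2 ∂deepZeroMeasure h) := by
  have hπ := Real.pi_pos
  rw [integral_deepZeroMeasure h_cont]
  set T : UnitAddCircle → ℝ := fun x => ‖P.eval (AddCircle.toCircle x : ℂ)‖ ^ 2 with hT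
  set w : UnitAddCircle → ℝ := fun x => Real.exp (-h ‖x‖) with hw
  set S := ∫ x, w x * T x with hS
  have hTc : Continuous T := P.continuous_norm_sq_eval_toCircle
  have hT0 : ∀ x, 0 ≤ T x := fun x => by positivity
  have hTi : Integrable T :=
    hTc.integrable_of_hasCompactSupport (HasCompactSupport.of_compactSpace T)
  have hwTi : Integrable fun x => w x * T x := integrable_exp_neg_mul h_nonneg h_cont hTc
  have hLi : Integrable fun x => Real.log (T x) := by
    simpa [hT, Real.log_pow] using P.integrable_log_norm_eval_toCircle.const_mul 2
  have hL0 : 0 ≤ ∫ x, Real.log (T x) := by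
    have h1 : 1 ≤ P.mahlerMeasure :=
      one_le_mahlerMeasure_of_one_le_norm_leadingCoeff (by simp [hP.leadingCoeff])
    have h2 := Real.log_nonneg h1
    rw [← logMahlerMeasure_eq_log_MahlerMeasure, logMahlerMeasure_def,
      circleAverage_zero_one_eq_integral] at h2
    simp only [hT, Real.log_pow]
    rw [integral_const_mul]
    positivity
  have hTpos : ∀ᵐ x : ℝ ∂volume.restrict (Ioc (-θ) (-θ + 1)), 0 < T x := by
    filter_upwards [UnitAddCircle.ae_coe (ae_eval_toCircle_ne_zero hP.ne_zero) (-θ)] with x hx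
    positivity
  rw [show -θ + 1 = 1 - θ by ring] at hTpos
  have hsub1 : Ioc (-θ) θ ⊆ Ioc (-θ) (1 - θ) := Ioc_subset_Ioc_right (by linarith)
  have hsub2 : Ioc θ (1 - θ) ⊆ Ioc (-θ) (1 - θ) := Ioc_subset_Ioc_left (by linarith)
  have hii : ∀ {F : UnitAddCircle → ℝ}, Integrable F →
      IntervalIntegrable (fun x : ℝ => F x) volume (-θ) θ ∧
      IntervalIntegrable (fun x : ℝ => F x) volume θ (1 - θ) ∧
      ∫ x, F x = (∫ x : ℝ in (-θ)..θ, F x) + ∫ x : ℝ in θ..(1 - θ), F x := by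
    intro F hF
    have h1 := UnitAddCircle.intervalIntegrable_coe hF (-θ)
    rw [show -θ + 1 = 1 - θ by ring] at h1
    have h2 : IntervalIntegrable (fun x : ℝ => F x) volume (-θ) θ := h1.mono_set (by
      rw [uIcc_of_le (by linarith), uIcc_of_le (by linarith)]
      exact Icc_subset_Icc_right (by linarith))
    have h3 : IntervalIntegrable (fun x : ℝ => F x) volume θ (1 - θ) := h1.mono_set (by
      rw [uIcc_of_le (by linarith), uIcc_of_le (by linarith)]
      exact Icc_subset_Icc_left (by linarith))
    refine ⟨h2, h3, ?_⟩
    rw [intervalIntegral.integral_add_adjacent_intervals h2 h3,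
      ← UnitAddCircle.intervalIntegral_preimage (-θ), show -θ + 1 = 1 - θ by ring]
  obtain ⟨hT1, hT2, hTsum⟩ := hii hTi
  obtain ⟨hwT1, hwT2, hwTsum⟩ := hii hwTi
  obtain ⟨hL1, hL2, hLsum⟩ := hii hLi
  -- the norm on the two halves of the long arc
  have hnorm1 : ∀ x ∈ Icc θ (1 / 2), ‖(x : UnitAddCircle)‖ = x := fun x hx => by
    have hx0 : 0 ≤ x := hθ.le.trans hx.1
    rw [UnitAddCircle.norm_coe_of_abs_le (by rw [abs_of_nonneg hx0]; exact hx.2),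
      abs_of_nonneg hx0]
  have hnorm2 : ∀ x ∈ Icc (1 / 2) (1 - θ), ‖(x : UnitAddCircle)‖ = 1 - x := fun x hx => by
    have h1 : ((x : ℝ) : UnitAddCircle) = ((-(1 - x) : ℝ) : UnitAddCircle) := by
      have := AddCircle.coe_add_period (1 : ℝ) (-(1 - x))
      rw [← this]
      congr 1
      ring
    have hx0 : 0 ≤ 1 - x := by linarith [hx.2]
    rw [h1, AddCircle.coe_neg, norm_neg, UnitAddCircle.norm_coe_of_abs_le
      (by rw [abs_of_nonneg hx0]; linarith [hx.1]), abs_of_nonneg hx0]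
  have hnormE : ∀ x ∈ Icc θ (1 - θ), ‖(x : UnitAddCircle)‖ ∈ Icc θ (1 / 2) := fun x hx => by
    rcases le_total x (1 / 2) with h1 | h1
    · rw [hnorm1 x ⟨hx.1, h1⟩]; exact ⟨hx.1, h1⟩
    · rw [hnorm2 x ⟨h1, hx.2⟩]; exact ⟨by linarith [hx.2], by linarith⟩
  have hIcc : Icc θ (1 / 2) ⊆ Ioc 0 (1 / 2) := fun x hx => ⟨hθ.trans_le hx.1, hx.2⟩
  have hhi : IntervalIntegrable h volume θ (1 / 2) :=
    (h_cont.mono (by rw [uIcc_of_le (by linarith)]; exact hIcc)).intervalIntegrable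
  have hhE1 : IntervalIntegrable (fun x : ℝ => h ‖(x : UnitAddCircle)‖) volume θ (1 / 2) :=
    hhi.congr fun x hx => by
      rw [uIoc_of_le (by linarith)] at hx
      rw [hnorm1 x (Ioc_subset_Icc_self hx)]
  have hhi' : IntervalIntegrable (fun x => h (1 - x)) volume (1 / 2) (1 - θ) := by
    have := hhi.comp_sub_left 1
    rw [show (1 : ℝ) - 1 / 2 = 1 / 2 by norm_num] at this
    exact this.symm
  have hhE2 : IntervalIntegrable (fun x : ℝ => h ‖(x : UnitAddCircle)‖) volume (1 / 2) (1 - θ) :=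
    hhi'.congr fun x hx => by
      rw [uIoc_of_le (by linarith)] at hx
      rw [hnorm2 x (Ioc_subset_Icc_self hx)]
  have hhE := hhE1.trans hhE2
  have hhint : ∫ x : ℝ in θ..(1 - θ), h ‖(x : UnitAddCircle)‖ = 2 * ∫ x in θ..(1 / 2), h x := by
    rw [← intervalIntegral.integral_add_adjacent_intervals hhE1 hhE2,
      intervalIntegral.integral_congr (g := h) (a := θ) (b := 1 / 2) fun x hx => by
        rw [uIcc_of_le (by linarith)] at hx
        simp only [hnorm1 x hx],
      intervalIntegral.integral_congr (g := fun x => h (1 - x)) (a := 1 / 2) (b := 1 - θ)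
        fun x hx => by
        rw [uIcc_of_le (by linarith)] at hx
        simp only [hnorm2 x hx],
      intervalIntegral.integral_comp_sub_left h 1, sub_sub_cancel,
      show (1 : ℝ) - 1 / 2 = 1 / 2 by norm_num]
    ring
  -- the short arc
  obtain ⟨hI0, hI⟩ := intervalIntegral_log_le_mul_log (by linarith : -θ < θ)
    (ae_restrict_of_ae_restrict_of_subset hsub1 hTpos) hT1 hL1
  -- the long arc
  have hTposE := ae_restrict_of_ae_restrict_of_subset hsub2 hTpos
  have hlogE : ∀ᵐ x : ℝ ∂volume.restrict (Ioc θ (1 - θ)),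
      Real.log (T x) - h ‖(x : UnitAddCircle)‖ = Real.log (w x * T x) := by
    filter_upwards [hTposE] with x hx
    rw [Real.log_mul (Real.exp_pos _).ne' hx.ne', Real.log_exp]
    ring
  have hlogE' : (fun x : ℝ => Real.log (T x) - h ‖(x : UnitAddCircle)‖)
      =ᵐ[volume.restrict (uIoc θ (1 - θ))] fun x : ℝ => Real.log (w x * T x) := by
    rw [uIoc_of_le (by linarith)]
    exact hlogE
  obtain ⟨hE0, hE⟩ := intervalIntegral_log_le_mul_log (u := fun x : ℝ => w x * T x)
    (by linarith : θ < 1 - θ) (hTposE.mono fun x hx => mul_pos (Real.exp_pos _) hx) hwT2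
    ((hL2.sub hhE).congr_ae hlogE')
  rw [← intervalIntegral.integral_congr_ae_restrict hlogE',
    intervalIntegral.integral_sub hL2 hhE, hhint] at hE
  set SE := ∫ x : ℝ in θ..(1 - θ), w x * T x with hSE
  have hSE' : SE ≤ S := by
    rw [hS, hwTsum, le_add_iff_nonneg_left]
    exact intervalIntegral.integral_nonneg (by linarith) fun x _ =>
      mul_nonneg (Real.exp_pos _).le (hT0 _)
  have hS0 : 0 < S := hE0.trans_le hSE'
  refine ⟨hS0, ?_⟩
  -- comparison of the two arcs
  have hTE : ∫ x : ℝ in θ..(1 - θ), T x ≤ Real.exp (h θ) * SE := by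
    rw [hSE, ← intervalIntegral.integral_const_mul]
    refine intervalIntegral.integral_mono_on (by linarith) hT2 (hwT2.const_mul _) fun x hx => ?_
    rw [← mul_assoc, hw, ← Real.exp_add]
    refine le_mul_of_one_le_left (hT0 _) (Real.one_le_exp ?_)
    have := h_anti.antitoneOn ⟨hθ, by linarith⟩ (hIcc (hnormE x hx)) (hnormE x hx).1
    linarith
  have hTexp : ∀ x : ℝ, T x = ‖P.eval (Complex.exp (2 * Real.pi * x * Complex.I))‖ ^ 2 := by
    intro x
    rw [hT, ← UnitAddCircle.coe_toCircle]
  have hI0' : 0 ≤ ∫ x : ℝ in θ..(1 - θ), T x :=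
    intervalIntegral.integral_nonneg (by linarith) fun x _ => hT0 _
  have hrem := P.integral_arc_le hPn.le hθ hθ'
  simp only [← hTexp] at hrem
  have hn1 : (1 : ℝ) ≤ n := by exact_mod_cast hn
  -- Here `80 = 4 * 20`: `2 (n + 1) ≤ 4 n`, and `tan (3 π θ) ≤ 6 π θ ≤ 20 θ`.
  have htan : 2 * (n + 1) * Real.tan (3 * Real.pi * θ) ≤ 80 * n * θ := by
    have h1 : 3 * Real.pi * θ ≤ 1 := by nlinarith [Real.pi_lt_d2]
    have h2 := Real.tan_le_two_mul (x := 3 * Real.pi * θ) (by positivity) h1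
    have h3 : 2 * (3 * Real.pi * θ) ≤ 20 * θ := by nlinarith [Real.pi_lt_d2]
    calc 2 * ((n : ℝ) + 1) * Real.tan (3 * Real.pi * θ) ≤ 2 * (n + n) * (20 * θ) := by
          refine mul_le_mul (by linarith) (h2.trans h3) ?_ (by positivity)
          exact Real.tan_nonneg_of_nonneg_of_le_pi_div_two (by positivity)
            (by linarith [Real.pi_gt_three])
      _ = 80 * n * θ := by ring
  have hI2 : (∫ x : ℝ in (-θ)..θ, T x) / (θ - -θ) ≤
      Real.exp (80 * n * θ) * Real.exp (h θ) * S / (8 * θ ^ 2) := by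
    rw [div_le_div_iff₀ (by linarith) (by positivity)]
    have : ∫ x : ℝ in (-θ)..θ, T x ≤ Real.exp (80 * n * θ) / (4 * θ) * (Real.exp (h θ) * S) := by
      refine hrem.trans (mul_le_mul (by gcongr) (hTE.trans (by gcongr)) hI0' (by positivity))
    calc _ ≤ Real.exp (80 * n * θ) / (4 * θ) * (Real.exp (h θ) * S) * (8 * θ ^ 2) := by gcongr
      _ = _ := by field_simp; ring
  have hI3 : ∫ x : ℝ in (-θ)..θ, Real.log (T x) ≤
      2 * θ * (80 * n * θ + h θ + Real.log S - Real.log (8 * θ ^ 2)) := by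
    refine hI.trans ?_
    rw [show θ - -θ = 2 * θ by ring] at hI2 ⊢
    refine mul_le_mul_of_nonneg_left ((Real.log_le_log (by positivity) hI2).trans_eq ?_)
      (by positivity)
    rw [Real.log_div (by positivity) (by positivity), Real.log_mul (by positivity) (by positivity),
      Real.log_mul (by positivity) (by positivity), Real.log_exp, Real.log_exp]
  have hE2 : (1 - θ - θ) * Real.log (SE / (1 - θ - θ)) ≤
      (1 - 2 * θ) * (Real.log S - Real.log (1 - 2 * θ)) := by
    rw [show 1 - θ - θ = 1 - 2 * θ by ring, Real.log_div hE0.ne' (by linarith)]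
    have := Real.log_le_log hE0 hSE'
    exact mul_le_mul_of_nonneg_left (by linarith) (by linarith)
  have hlog1 := Real.neg_mul_log_le_one (x := 1 - 2 * θ) (by linarith)
  have hlog2 : -(2 * θ * Real.log (8 * θ ^ 2)) ≤ 4 := by
    rw [Real.log_mul (by norm_num) (by positivity), Real.log_pow]
    have h1 := Real.neg_mul_log_le_one hθ
    have h2 := mul_nonneg hθ.le (Real.log_nonneg (by norm_num : (1 : ℝ) ≤ 8))
    push_cast
    nlinarith
  -- The arcs have lengths `2 θ` and `1 - 2 θ`, so `log S` appears with total coefficient `1`; the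
  -- two normalization terms are bounded by `hlog1` and `hlog2`, whence `5 = 1 + 4`.
  rw [hLsum] at hL0
  nlinarith

/-! ### Dirichlet polynomials and Jackson type kernels -/

open Polynomial in
/-- The Dirichlet polynomial `1 + X + ⋯ + X ^ (N - 1)`. -/
noncomputable def dirichletPolynomial (N : ℕ) : ℂ[X] := ∑ j ∈ Finset.range N, X ^ j

lemma eval_dirichletPolynomial (N : ℕ) (z : ℂ) :
    (dirichletPolynomial N).eval z = ∑ j ∈ Finset.range N, z ^ j := by
  simp [dirichletPolynomial, Polynomial.eval_finsetSum]

lemma norm_eval_dirichletPolynomial_mul_le (N : ℕ) (x : UnitAddCircle) :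
    ‖(dirichletPolynomial N).eval (AddCircle.toCircle x : ℂ)‖ * (2 * ‖x‖) ≤ 1 := by
  have h1 := geom_sum_mul (AddCircle.toCircle x : ℂ) N
  have h2 : ‖(AddCircle.toCircle x : ℂ) ^ N - 1‖ ≤ 2 := by
    refine (norm_sub_le _ _).trans_eq ?_
    rw [norm_pow, Circle.norm_coe, one_pow, norm_one]
    norm_num
  rw [← h1, norm_mul, ← eval_dirichletPolynomial] at h2
  have h3 := x.four_mul_norm_le_norm_toCircle_sub_one
  nlinarith [mul_le_mul_of_nonneg_left h3
    (norm_nonneg ((dirichletPolynomial N).eval (AddCircle.toCircle x : ℂ)))]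

lemma norm_pow_sub_one_le_mul {z : ℂ} (hz : ‖z‖ = 1) (j : ℕ) : ‖z ^ j - 1‖ ≤ j * ‖z - 1‖ := by
  rw [← geom_sum_mul, norm_mul]
  refine mul_le_mul_of_nonneg_right ((norm_sum_le _ _).trans_eq ?_) (norm_nonneg _)
  simp [hz]

lemma half_le_norm_eval_dirichletPolynomial {N : ℕ} (hN : 1 ≤ N) {x : UnitAddCircle}
    (hx : ‖x‖ ≤ 1 / (4 * Real.pi * N)) :
    (N : ℝ) / 2 ≤ ‖(dirichletPolynomial N).eval (AddCircle.toCircle x : ℂ)‖ := by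
  have hπ := Real.pi_pos
  have hN' : (0 : ℝ) < N := by exact_mod_cast hN
  rw [le_div_iff₀ (by positivity)] at hx
  have h1 : ‖(N : ℂ) - (dirichletPolynomial N).eval (AddCircle.toCircle x : ℂ)‖ ≤ N / 2 := by
    have : (N : ℂ) - (dirichletPolynomial N).eval (AddCircle.toCircle x : ℂ) =
        ∑ j ∈ Finset.range N, (1 - (AddCircle.toCircle x : ℂ) ^ j) := by
      rw [eval_dirichletPolynomial, Finset.sum_sub_distrib]
      simp
    rw [this]
    refine (norm_sum_le_of_le (f := fun j => 1 - (AddCircle.toCircle x : ℂ) ^ j)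
      (n := fun _ => 1 / 2) _ fun j hj => ?_).trans_eq (by simp; ring)
    rw [norm_sub_rev]
    refine (norm_pow_sub_one_le_mul (Circle.norm_coe _) j).trans ?_
    have hjN : (j : ℝ) ≤ N := by exact_mod_cast (Finset.mem_range.1 hj).le
    calc (j : ℝ) * ‖(AddCircle.toCircle x : ℂ) - 1‖ ≤ N * (2 * Real.pi * ‖x‖) := by
          gcongr
          exact x.norm_toCircle_sub_one_le
      _ ≤ 1 / 2 := by linarith
  have h2 := norm_sub_norm_le (N : ℂ) ((N : ℂ) -
    (dirichletPolynomial N).eval (AddCircle.toCircle x : ℂ))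
  rw [sub_sub_cancel, Complex.norm_natCast] at h2
  linarith

lemma integral_norm_sq_eval_dirichletPolynomial (N : ℕ) :
    ∫ x : UnitAddCircle, ‖(dirichletPolynomial N).eval (AddCircle.toCircle x : ℂ)‖ ^ 2 = N := by
  rw [← circleAverage_zero_one_eq_integral (fun z => ‖(dirichletPolynomial N).eval z‖ ^ 2),
    ← Polynomial.sum_sq_norm_coeff_eq_circleAverage]
  have hc : ∀ i, (dirichletPolynomial N).coeff i = if i < N then 1 else 0 := by
    intro i
    simp [dirichletPolynomial, Polynomial.coeff_X_pow]
  have hs : (dirichletPolynomial N).support = Finset.range N := by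
    ext i
    simp [hc]
  rw [hs, Finset.sum_congr rfl (g := fun _ => (1 : ℝ)) fun i hi => by
    rw [hc, if_pos (Finset.mem_range.1 hi)]; simp]
  simp

/-- The unnormalized Jackson type kernel. -/
noncomputable def jacksonPower (N k : ℕ) (x : UnitAddCircle) : ℝ :=
  ‖(dirichletPolynomial N).eval (AddCircle.toCircle x : ℂ)‖ ^ (2 * k)

lemma jacksonPower_nonneg (N k : ℕ) (x : UnitAddCircle) : 0 ≤ jacksonPower N k x := by
  unfold jacksonPower; positivity

lemma continuous_jacksonPower (N k : ℕ) : Continuous (jacksonPower N k) :=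
  ((dirichletPolynomial N).continuous.comp
    (continuous_subtype_val.comp AddCircle.continuous_toCircle)).norm.pow _

lemma Continuous.integrable_unitAddCircle {f : UnitAddCircle → ℝ} (hf : Continuous f) :
    Integrable f :=
  hf.integrable_of_hasCompactSupport (HasCompactSupport.of_compactSpace f)

/-- The Dirichlet polynomial is at least `N / 2` in modulus on a ball of measure `1 / (2 π N)`; this
bounds the normalizing constant of the kernel from below. -/
lemma le_integral_jacksonPower {N : ℕ} (hN : 1 ≤ N) (k : ℕ) :
    ((N : ℝ) / 2) ^ (2 * k) / (2 * Real.pi * N) ≤ ∫ x, jacksonPower N k x := by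
  have hπ := Real.pi_gt_three
  have hN' : (1 : ℝ) ≤ N := by exact_mod_cast hN
  have hv : (volume : Measure UnitAddCircle).real
      (Metric.closedBall 0 (1 / (4 * Real.pi * N))) = 1 / (2 * Real.pi * N) := by
    rw [measureReal_def, AddCircle.volume_closedBall, min_eq_right, ENNReal.toReal_ofReal]
    · field_simp; norm_num
    · positivity
    · rw [mul_one_div, div_le_one (by positivity)]
      nlinarith
  calc ((N : ℝ) / 2) ^ (2 * k) / (2 * Real.pi * N)
      = ∫ x in Metric.closedBall (0 : UnitAddCircle) (1 / (4 * Real.pi * N)),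
          ((N : ℝ) / 2) ^ (2 * k) := by
        rw [setIntegral_const, hv, smul_eq_mul]; ring
    _ ≤ ∫ x in Metric.closedBall (0 : UnitAddCircle) (1 / (4 * Real.pi * N)),
          jacksonPower N k x := by
        refine setIntegral_mono_on (integrable_const _).integrableOn
          (continuous_jacksonPower N k).integrable_unitAddCircle.integrableOn
          measurableSet_closedBall fun x hx => ?_
        rw [mem_closedBall_zero_iff] at hx
        exact pow_le_pow_left₀ (by positivity) (half_le_norm_eval_dirichletPolynomial hN hx) _
    _ ≤ ∫ x, jacksonPower N k x :=
        setIntegral_le_integral (continuous_jacksonPower N k).integrable_unitAddCircle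
          (ae_of_all _ fun x => jacksonPower_nonneg N k x)

/-- Of the `2 (k + 1)` factors, `2 k` are bounded pointwise by `1 / (2 r)` away from `0`, and
Parseval's identity gives `N` for the remaining square. -/
lemma setIntegral_jacksonPower_le (N k : ℕ) {r : ℝ} (hr : 0 < r) :
    ∫ x in {x : UnitAddCircle | r ≤ ‖x‖}, jacksonPower N (k + 1) x ≤
      (1 / (2 * r)) ^ (2 * k) * N := by
  have hc := (dirichletPolynomial N).continuous_norm_sq_eval_toCircle
  calc ∫ x in {x : UnitAddCircle | r ≤ ‖x‖}, jacksonPower N (k + 1) x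
      ≤ ∫ x in {x : UnitAddCircle | r ≤ ‖x‖}, (1 / (2 * r)) ^ (2 * k) *
          ‖(dirichletPolynomial N).eval (AddCircle.toCircle x : ℂ)‖ ^ 2 := by
        refine setIntegral_mono_on
          (continuous_jacksonPower N _).integrable_unitAddCircle.integrableOn
          (hc.integrable_unitAddCircle.const_mul _).integrableOn
          (isClosed_le continuous_const continuous_norm).measurableSet fun x hx => ?_
        rw [jacksonPower, mul_add, mul_one, pow_add]
        refine mul_le_mul_of_nonneg_right (pow_le_pow_left₀ (norm_nonneg _) ?_ _) (by positivity)
        rw [le_div_iff₀ (by positivity)]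
        refine le_trans ?_ (norm_eval_dirichletPolynomial_mul_le N x)
        gcongr
        exact hx
    _ ≤ ∫ x : UnitAddCircle, (1 / (2 * r)) ^ (2 * k) *
          ‖(dirichletPolynomial N).eval (AddCircle.toCircle x : ℂ)‖ ^ 2 :=
        setIntegral_le_integral (hc.integrable_unitAddCircle.const_mul _)
          (ae_of_all _ fun x => by positivity)
    _ = _ := by rw [integral_const_mul, integral_norm_sq_eval_dirichletPolynomial]

open Polynomial in
/-- Averages of polynomials with continuously varying coefficients. -/
lemma Polynomial.exists_eval_eq_integral {S : UnitAddCircle → ℂ[X]} {d : ℕ}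
    (hd : ∀ y, (S y).natDegree ≤ d) (hc : ∀ j, Continuous fun y => (S y).coeff j)
    {G : UnitAddCircle → ℝ} (hG : Integrable G) :
    ∃ p : ℂ[X], p.natDegree ≤ d ∧ ∀ z, p.eval z = ∫ y, (S y).eval z * G y := by
  have hi : ∀ j, Integrable fun y => (S y).coeff j * G y := by
    intro j
    obtain ⟨c, hc'⟩ := (isCompact_univ.image (hc j).norm).bddAbove
    exact (hG.ofReal (𝕜 := ℂ)).bdd_mul (c := c) (hc j).aestronglyMeasurable
      (ae_of_all _ fun y => hc' ⟨y, mem_univ _, rfl⟩)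
  refine ⟨∑ j ∈ Finset.range (d + 1), C (∫ y, (S y).coeff j * G y) * X ^ j, ?_, fun z => ?_⟩
  · refine natDegree_sum_le_of_forall_le _ _ fun k hk => (natDegree_C_mul_X_pow_le _ _).trans ?_
    simp only [Finset.mem_range] at hk
    omega
  · have : ∀ y, (S y).eval z * G y =
        ∑ j ∈ Finset.range (d + 1), z ^ j * ((S y).coeff j * G y) := by
      intro y
      rw [eval_eq_sum_range' (Nat.lt_succ_of_le (hd y)), Finset.sum_mul]
      exact Finset.sum_congr rfl fun j _ => by ring
    simp_rw [this]
    rw [integral_finsetSum _ fun j _ => (hi j).const_mul _, eval_finsetSum]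
    refine Finset.sum_congr rfl fun j _ => ?_
    rw [integral_const_mul, eval_mul, eval_C, eval_pow, eval_X, mul_comm]

open Polynomial in
lemma Polynomial.continuous_coeff_mul {Y : Type*} [TopologicalSpace Y] {f g : Y → ℂ[X]}
    (hf : ∀ j, Continuous fun y => (f y).coeff j) (hg : ∀ j, Continuous fun y => (g y).coeff j)
    (j : ℕ) : Continuous fun y => (f y * g y).coeff j := by
  simp only [coeff_mul]
  exact continuous_finsetSum _ fun i _ => (hf _).mul (hg _)

open Polynomial in
lemma Polynomial.continuous_coeff_pow {Y : Type*} [TopologicalSpace Y] {f : Y → ℂ[X]}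
    (hf : ∀ j, Continuous fun y => (f y).coeff j) (k j : ℕ) :
    Continuous fun y => (f y ^ k).coeff j := by
  induction k generalizing j with
  | zero => simp only [pow_zero]; exact continuous_const
  | succ k ih => simp only [pow_succ]; exact continuous_coeff_mul ih hf j

open Polynomial in
/-- The convolution with a Jackson type kernel is the modulus of a polynomial. -/
lemma exists_polynomial_norm_eval_eq_integral_jacksonPower {N : ℕ} (hN : 1 ≤ N) (k : ℕ)
    {G : UnitAddCircle → ℝ} (hG : Integrable G) (hG0 : ∀ y, 0 ≤ G y) :
    ∃ p : ℂ[X], p.natDegree ≤ 2 * k * N ∧ ∀ x : UnitAddCircle,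
      ‖p.eval (AddCircle.toCircle x : ℂ)‖ = ∫ y, jacksonPower N k (x - y) * G y := by
  -- At `z = toCircle x`, `f y` is the Dirichlet polynomial translated by `y`, and `f' y` is `z ^ (N
  -- - 1)` times its conjugate. Thus `f y ^ k * f' y ^ k` is the kernel at `x - y` up to a
  -- unimodular factor independent of `y`, which the modulus removes after integration.
  let f : UnitAddCircle → ℂ[X] := fun y =>
    ∑ j ∈ Finset.range N, C ((AddCircle.toCircle (-y) : ℂ) ^ j) * X ^ j
  let f' : UnitAddCircle → ℂ[X] := fun y =>
    ∑ j ∈ Finset.range N, C ((AddCircle.toCircle y : ℂ) ^ j) * X ^ (N - 1 - j)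
  have hz : Continuous fun y : UnitAddCircle => (AddCircle.toCircle y : ℂ) :=
    continuous_subtype_val.comp AddCircle.continuous_toCircle
  have hf : ∀ j, Continuous fun y => (f y).coeff j := fun j => by
    simp only [f, finsetSum_coeff, coeff_C_mul]
    exact continuous_finsetSum _ fun i _ => ((hz.comp continuous_neg).pow _).mul continuous_const
  have hf' : ∀ j, Continuous fun y => (f' y).coeff j := fun j => by
    simp only [f', finsetSum_coeff, coeff_C_mul]
    exact continuous_finsetSum _ fun i _ => (hz.pow _).mul continuous_const
  have hfd : ∀ y, (f y).natDegree ≤ N := fun y =>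
    natDegree_sum_le_of_forall_le _ _ fun j hj => (natDegree_C_mul_X_pow_le _ _).trans
      (Finset.mem_range.1 hj).le
  have hfd' : ∀ y, (f' y).natDegree ≤ N := fun y =>
    natDegree_sum_le_of_forall_le _ _ fun j hj => (natDegree_C_mul_X_pow_le _ _).trans (by omega)
  obtain ⟨p, hpd, hp⟩ := exists_eval_eq_integral (S := fun y => f y ^ k * f' y ^ k)
    (d := 2 * k * N) (fun y => by
      refine natDegree_mul_le.trans ((add_le_add (natDegree_pow_le_of_le k (hfd y))
        (natDegree_pow_le_of_le k (hfd' y))).trans_eq (by ring)))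
    (continuous_coeff_mul (continuous_coeff_pow hf k) (continuous_coeff_pow hf' k)) hG
  refine ⟨p, hpd, fun x => ?_⟩
  have key : ∀ y, (f y ^ k * f' y ^ k).eval (AddCircle.toCircle x : ℂ) =
      (AddCircle.toCircle x : ℂ) ^ ((N - 1) * k) * jacksonPower N k (x - y) := by
    intro y
    have e1 : (f y).eval (AddCircle.toCircle x : ℂ) =
        (dirichletPolynomial N).eval (AddCircle.toCircle (x - y) : ℂ) := by
      simp only [f, eval_finsetSum, eval_mul, eval_C, eval_pow, eval_X, eval_dirichletPolynomial]
      refine Finset.sum_congr rfl fun j _ => ?_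
      rw [← mul_pow, sub_eq_neg_add, AddCircle.toCircle_add, Circle.coe_mul]
    have e2 : (f' y).eval (AddCircle.toCircle x : ℂ) = (AddCircle.toCircle x : ℂ) ^ (N - 1) *
        starRingEnd ℂ ((dirichletPolynomial N).eval (AddCircle.toCircle (x - y) : ℂ)) := by
      simp only [f', eval_finsetSum, eval_mul, eval_C, eval_pow, eval_X, eval_dirichletPolynomial,
        map_sum, map_pow, Finset.mul_sum]
      refine Finset.sum_congr rfl fun j hj => ?_
      have hj' : N - 1 = (N - 1 - j) + j := by
        have := Finset.mem_range.1 hj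
        omega
      conv_rhs => rw [hj', pow_add]
      rw [← Circle.coe_inv_eq_conj, ← AddCircle.toCircle_neg, neg_sub, mul_assoc, ← mul_pow,
        ← Circle.coe_mul, ← AddCircle.toCircle_add, add_sub_cancel, mul_comm]
    rw [eval_mul, eval_pow, eval_pow, e1, e2, mul_pow, mul_left_comm, ← mul_pow, Complex.mul_conj,
      Complex.normSq_eq_norm_sq, jacksonPower, ← pow_mul]
    push_cast
    rw [← pow_mul]
  rw [hp]
  simp_rw [key, mul_assoc]
  rw [integral_const_mul, norm_mul, norm_pow, Circle.norm_coe, one_pow, one_mul]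
  simp_rw [← Complex.ofReal_mul]
  rw [integral_complex_ofReal, Complex.norm_real, Real.norm_of_nonneg]
  exact integral_nonneg fun y => mul_nonneg (jacksonPower_nonneg _ _ _) (hG0 y)

/-- The exponential lies above its tangent at the mean `a`; integrating against the probability
density `κ` gives Jensen's inequality. It bounds the smoothed `exp g` from below by the exponential
of the smoothed `g`. -/
lemma exp_integral_mul_le {α : Type*} [MeasurableSpace α] {μ : Measure α} {g κ : α → ℝ}
    (hκ0 : ∀ x, 0 ≤ κ x) (hκ : Integrable κ μ) (hκ1 : ∫ x, κ x ∂μ = 1)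
    (hg : Integrable (fun x => g x * κ x) μ)
    (he : Integrable (fun x => Real.exp (g x) * κ x) μ) :
    Real.exp (∫ x, g x * κ x ∂μ) ≤ ∫ x, Real.exp (g x) * κ x ∂μ := by
  set a := ∫ x, g x * κ x ∂μ with ha
  calc Real.exp a = ∫ x, Real.exp a * ((1 - a) * κ x + g x * κ x) ∂μ := by
        rw [integral_const_mul, integral_add (hκ.const_mul _) hg, integral_const_mul, hκ1, ← ha]
        ring
    _ ≤ ∫ x, Real.exp (g x) * κ x ∂μ := by
        refine integral_mono (((hκ.const_mul _).add hg).const_mul _) he fun x => ?_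
        have h1 := Real.add_one_le_exp (g x - a)
        have h2 : Real.exp (g x) = Real.exp a * Real.exp (g x - a) := by
          rw [← Real.exp_add]; ring_nf
        simp only [h2]
        have h3 := mul_le_mul_of_nonneg_right h1 (hκ0 x)
        rw [mul_assoc]
        refine mul_le_mul_of_nonneg_left ?_ (Real.exp_pos _).le
        linarith

/-! ### Upper bound for the Szegő error by a smoothed competitor -/

open Polynomial in
/-- Upper bound for the Szegő error in terms of a minorant `g` of `h` which varies slowly at the
scale `θ`. -/
lemma szegoError_le_mul_exp_neg_integral {h : ℝ → ℝ}
    (h_nonneg : ∀ θ ∈ Ioc (0 : ℝ) (1 / 2), 0 ≤ h θ)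
    (h_cont : ContinuousOn h (Ioc 0 (1 / 2))) (h_anti : StrictAntiOn h (Ioc 0 (1 / 2)))
    {n : ℕ} {θ : ℝ} (hθ : 0 < θ) (hθ' : θ ≤ 1 / 2) (hn : 10 ≤ n * θ)
    {g : UnitAddCircle → ℝ} {a : ℝ} (hgm : AEMeasurable g) (hg0 : ∀ x, 0 ≤ g x)
    (hga : ∀ x, g x ≤ a) (ha : a ≤ n * θ / 10) (ha2 : 2 * a ≤ h θ)
    (hgh : ∀ x y : UnitAddCircle, θ < ‖x‖ → ‖x‖ / 2 < ‖y‖ → 2 * g y ≤ h ‖x‖) :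
    szegoError (deepZeroMeasure h) n ≤ (1 + 128 * Real.pi) * Real.exp (-∫ x, g x) := by
  have hπ := Real.pi_pos
  -- At distance `θ / 2` the Dirichlet polynomial is at most `1 / θ ≤ N / 4`, half of its size `N /
  -- 2` near `0`, so each additional square in the kernel gains a factor `1 / 4` in the tail.
  set N := ⌈4 / θ⌉₊ with hN
  have hN1 : 4 ≤ N * θ := by
    rw [← div_le_iff₀ hθ]
    exact Nat.le_ceil _
  have hN2 : N * θ ≤ 5 := by
    have h1 := (Nat.ceil_lt_add_one (by positivity : 0 ≤ 4 / θ)).le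
    rw [← hN] at h1
    calc (N : ℝ) * θ ≤ (4 / θ + 1) * θ := by gcongr
      _ = 4 + θ := by field_simp
      _ ≤ 5 := by linarith
  have hNpos : (0 : ℝ) < N := by
    by_contra hcon
    nlinarith
  have hNn : 1 ≤ N := by exact_mod_cast hNpos
  -- The exponent is the largest for which the kernel has degree at most `n`; it is positive since
  -- `2 N θ ≤ 10 ≤ n θ`.
  obtain ⟨k, hk⟩ : ∃ k, n / (2 * N) = k + 1 := by
    refine Nat.exists_eq_add_one.2 (Nat.div_pos ?_ (by omega))
    have : (2 * N : ℝ) * θ ≤ n * θ := by linarith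
    exact_mod_cast le_of_mul_le_mul_right this hθ
  have hk2 : n * θ / 10 ≤ k + 2 := by
    have h1 : n < 2 * N * (n / (2 * N) + 1) := Nat.lt_mul_div_succ n (by omega)
    rw [hk] at h1
    have h2 : (n : ℝ) ≤ 2 * N * (k + 1 + 1) := by exact_mod_cast h1.le
    calc n * θ / 10 ≤ 2 * N * (k + 1 + 1) * θ / 10 := by gcongr
      _ = (N * θ) * (k + 2) / 5 := by ring
      _ ≤ 5 * (k + 2) / 5 := by gcongr
      _ = k + 2 := by ring
  set J := jacksonPower N (k + 1) with hJ
  have hJ0 : ∀ x, 0 ≤ J x := jacksonPower_nonneg _ _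
  have hJc : Continuous J := continuous_jacksonPower _ _
  set Z := ∫ x, J x with hZ
  have hZle := le_integral_jacksonPower hNn (k + 1)
  rw [← hJ, ← hZ] at hZle
  have hZ0 : 0 < Z := lt_of_lt_of_le (by positivity) hZle
  set K : UnitAddCircle → ℝ := fun x => J x / Z with hK
  have hK0 : ∀ x, 0 ≤ K x := fun x => div_nonneg (hJ0 x) hZ0.le
  have hKc : Continuous K := hJc.div_const _
  have hKi : Integrable K := hKc.integrable_unitAddCircle
  have hK1 : ∫ x, K x = 1 := by
    simp only [hK, integral_div, ← hZ, div_self hZ0.ne']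
  have hKs : ∀ x, Integrable fun y => K (x - y) := fun x => hKi.comp_sub_left x
  have hKs1 : ∀ x, ∫ y, K (x - y) = 1 := fun x => by
    rw [integral_sub_left_eq_self K volume x, hK1]
  -- the tail of the kernel
  set E : Set UnitAddCircle := {x | θ / 2 ≤ ‖x‖} with hE
  have hEm : MeasurableSet E := (isClosed_le continuous_const continuous_norm).measurableSet
  -- The tail mass is at most `8 π (1 / 4) ^ k`, while `a ≤ n θ / 10 ≤ k + 2` and `e < 4` give `exp
  -- a ≤ 4 ^ (k + 2)`; the product is `128 π`.
  have htail : Real.exp a * ∫ x in E, K x ≤ 128 * Real.pi := by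
    have h1 := setIntegral_jacksonPower_le N k (half_pos hθ)
    rw [← hJ, ← hE] at h1
    have h2 : ∫ x in E, K x ≤ 8 * Real.pi * (1 / 4) ^ k := by
      simp only [hK]
      rw [integral_div, div_le_iff₀ hZ0]
      refine h1.trans ?_
      calc (1 / (2 * (θ / 2))) ^ (2 * k) * N
          ≤ (N / 4) ^ (2 * k) * N := by
            refine mul_le_mul_of_nonneg_right (pow_le_pow_left₀ (by positivity) ?_ _) hNpos.le
            rw [mul_div_cancel₀ _ two_ne_zero, div_le_div_iff₀ hθ (by norm_num)]
            linarith
        _ = 8 * Real.pi * (1 / 4) ^ k * (((N : ℝ) / 2) ^ (2 * (k + 1)) / (2 * Real.pi * N)) := by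
            rw [show ((N : ℝ) / 4) ^ (2 * k) = (1 / 4) ^ k * ((N : ℝ) / 2) ^ (2 * k) by
              rw [pow_mul, pow_mul, ← mul_pow]; ring]
            rw [mul_add, mul_one, pow_add]
            field_simp
            ring
        _ ≤ _ := by gcongr
    have h3 : Real.exp a ≤ 4 ^ (k + 2) := by
      calc Real.exp a ≤ Real.exp ((k + 2 : ℕ) * 1) := by
            apply Real.exp_le_exp.2
            push_cast
            linarith
        _ = Real.exp 1 ^ (k + 2) := Real.exp_nat_mul _ _
        _ ≤ 4 ^ (k + 2) := by
            gcongr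
            linarith [Real.exp_one_lt_d9]
    calc Real.exp a * ∫ x in E, K x ≤ 4 ^ (k + 2) * (8 * Real.pi * (1 / 4) ^ k) := by
          gcongr
          exact setIntegral_nonneg hEm fun x _ => hK0 x
      _ = 128 * Real.pi * (4 * (1 / 4)) ^ k := by rw [mul_pow]; ring
      _ = 128 * Real.pi := by norm_num
  -- the polynomial
  have hem : AEStronglyMeasurable (fun y => Real.exp (g y)) :=
    (Real.measurable_exp.comp_aemeasurable hgm).aestronglyMeasurable
  have hgi : Integrable g := Integrable.of_bound hgm.aestronglyMeasurable a
    (ae_of_all _ fun x => by rw [Real.norm_of_nonneg (hg0 x)]; exact hga x)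
  have heb : ∀ y, ‖Real.exp (g y)‖ ≤ Real.exp a := fun y => by
    rw [Real.norm_eq_abs, Real.abs_exp]
    exact Real.exp_le_exp.2 (hga y)
  have hei : Integrable fun y => Real.exp (g y) := Integrable.of_bound hem _ (ae_of_all _ heb)
  obtain ⟨p, hpd, hp⟩ := exists_polynomial_norm_eval_eq_integral_jacksonPower hNn (k + 1)
    (hei.div_const Z) fun y => div_nonneg (Real.exp_pos _).le hZ0.le
  have hpR : ∀ x : UnitAddCircle, ‖p.eval (AddCircle.toCircle x : ℂ)‖ =
      ∫ y, Real.exp (g y) * K (x - y) := fun x => by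
    rw [hp]
    refine integral_congr_ae (ae_of_all _ fun y => ?_)
    simp only [hK, hJ]
    ring
  have hpn : p.natDegree ≤ n := hpd.trans (by
    rw [← hk, mul_comm 2, mul_assoc]
    exact Nat.div_mul_le_self _ _)
  have hRi : ∀ x, Integrable fun y => Real.exp (g y) * K (x - y) := fun x =>
    (hKs x).bdd_mul hem (ae_of_all _ heb)
  have hgKi : ∀ x, Integrable fun y => g y * K (x - y) := fun x =>
    (hKs x).bdd_mul (c := a) hgm.aestronglyMeasurable
      (ae_of_all _ fun x => by rw [Real.norm_of_nonneg (hg0 x)]; exact hga x)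
  have hlow : ∀ x : UnitAddCircle, Real.exp (∫ y, g y * K (x - y)) ≤
      ‖p.eval (AddCircle.toCircle x : ℂ)‖ := fun x => by
    rw [hpR]
    exact exp_integral_mul_le (fun y => hK0 _) (hKs x) (hKs1 x) (hgKi x) (hRi x)
  have hp0 : p ≠ 0 := by
    rintro rfl
    have := hlow 0
    rw [eval_zero, norm_zero] at this
    exact absurd this (not_le.2 (Real.exp_pos _))
  -- Convolution with the kernel of mass one preserves `∫ g`, so integrating the logarithm of `hlow`
  -- over the circle gives the claim.
  have hmahler : Real.exp (∫ x, g x) ≤ p.mahlerMeasure := by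
    rw [← Real.exp_log (mahlerMeasure_pos_of_ne_zero hp0), ← logMahlerMeasure_eq_log_MahlerMeasure,
      logMahlerMeasure_def, circleAverage_zero_one_eq_integral]
    refine Real.exp_le_exp.2 ?_
    have h1 := integral_convolution (ContinuousLinearMap.mul ℝ ℝ) hgi hKi
    rw [hK1, ContinuousLinearMap.mul_apply', mul_one] at h1
    rw [← h1]
    refine integral_mono (hgi.integrable_convolution (ContinuousLinearMap.mul ℝ ℝ) hKi)
      p.integrable_log_norm_eval_toCircle fun x => ?_
    exact (Real.le_log_iff_exp_le ((Real.exp_pos _).trans_le (hlow x))).2 (hlow x)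
  have hup1 : ∀ x : UnitAddCircle, ‖p.eval (AddCircle.toCircle x : ℂ)‖ ≤ Real.exp a := fun x => by
    rw [hpR]
    calc ∫ y, Real.exp (g y) * K (x - y) ≤ ∫ y, Real.exp a * K (x - y) :=
          integral_mono (hRi x) ((hKs x).const_mul _) fun y =>
            mul_le_mul_of_nonneg_right (Real.exp_le_exp.2 (hga y)) (hK0 _)
      _ = Real.exp a := by rw [integral_const_mul, hKs1, mul_one]
  have hup2 : ∀ x : UnitAddCircle, θ < ‖x‖ → ‖p.eval (AddCircle.toCircle x : ℂ)‖ ≤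
      Real.exp (h ‖x‖ / 2) + 128 * Real.pi := fun x hx => by
    have hind : Integrable (fun y => E.indicator K (x - y)) :=
      (hKi.indicator hEm).comp_sub_left x
    rw [hpR]
    calc ∫ y, Real.exp (g y) * K (x - y)
        ≤ ∫ y, (Real.exp (h ‖x‖ / 2) * K (x - y) + Real.exp a * E.indicator K (x - y)) := by
          refine integral_mono (hRi x) (((hKs x).const_mul _).add (hind.const_mul _)) fun y => ?_
          simp only
          -- Off the tail, `‖x - y‖ < θ / 2 < ‖x‖ / 2` forces `‖y‖ > ‖x‖ / 2`, so `hgh` applies; on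
          -- the tail only `g ≤ a` is used.
          by_cases hy : x - y ∈ E
          · rw [indicator_of_mem hy]
            have h1 := mul_le_mul_of_nonneg_right (Real.exp_le_exp.2 (hga y)) (hK0 (x - y))
            have h2 := mul_nonneg (Real.exp_pos (h ‖x‖ / 2)).le (hK0 (x - y))
            linarith
          · rw [indicator_of_notMem hy, mul_zero, add_zero]
            refine mul_le_mul_of_nonneg_right (Real.exp_le_exp.2 ?_) (hK0 _)
            have h1 : ‖x - y‖ < θ / 2 := not_le.1 hy
            have h2 := norm_sub_norm_le x y
            have h3 := hgh x y hx (by linarith)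
            linarith
      _ = Real.exp (h ‖x‖ / 2) + Real.exp a * ∫ y in E, K y := by
          rw [integral_add ((hKs x).const_mul _) (hind.const_mul _), integral_const_mul,
            integral_const_mul, hKs1, mul_one, integral_sub_left_eq_self (E.indicator K) volume x,
            integral_indicator hEm]
      _ ≤ _ := by gcongr
  have hfin : ∫ x, ‖p.eval (AddCircle.toCircle x : ℂ)‖ ^ 2 ∂deepZeroMeasure h ≤
      (1 + 128 * Real.pi) ^ 2 := by
    rw [integral_deepZeroMeasure h_cont]
    calc _ ≤ ∫ x : UnitAddCircle, (1 + 128 * Real.pi) ^ 2 := by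
          refine integral_mono_ae
            (integrable_exp_neg_mul h_nonneg h_cont p.continuous_norm_sq_eval_toCircle)
            (integrable_const _) ?_
          filter_upwards [UnitAddCircle.ae_norm_mem_Ioc] with x hx
          have h1 : Real.exp (-h ‖x‖) = Real.exp (-(h ‖x‖ / 2)) ^ 2 := by
            rw [← Real.exp_nat_mul]; congr 1; push_cast; ring
          rw [h1, ← mul_pow]
          refine pow_le_pow_left₀ (by positivity) ?_ 2
          rcases le_or_gt ‖x‖ θ with hxθ | hxθ
          · have h2 := h_anti.antitoneOn hx ⟨hθ, hθ'⟩ hxθ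
            calc _ ≤ Real.exp (-(h ‖x‖ / 2)) * Real.exp a := by
                  gcongr
                  exact hup1 x
              _ ≤ 1 := by
                  rw [← Real.exp_add, Real.exp_le_one_iff]
                  linarith
              _ ≤ _ := by linarith
          · have h2 := h_nonneg _ hx
            calc _ ≤ Real.exp (-(h ‖x‖ / 2)) * (Real.exp (h ‖x‖ / 2) + 128 * Real.pi) := by
                  gcongr
                  exact hup2 x hxθ
              _ = 1 + Real.exp (-(h ‖x‖ / 2)) * (128 * Real.pi) := by
                  rw [mul_add, ← Real.exp_add, neg_add_cancel, Real.exp_zero]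
              _ ≤ 1 + 1 * (128 * Real.pi) := by
                  gcongr
                  rw [Real.exp_le_one_iff]
                  linarith
              _ = _ := by ring
      _ = _ := by simp [measureReal_def]
  have hmain := szegoError_mul_mahlerMeasure_le (deepZeroMeasure h) hpn
  rw [Real.exp_neg, ← div_eq_mul_inv, le_div_iff₀ (Real.exp_pos _)]
  calc _ ≤ szegoError (deepZeroMeasure h) n * p.mahlerMeasure := by
        gcongr
        exact szegoError_nonneg _ _
    _ ≤ _ := hmain
    _ ≤ Real.sqrt ((1 + 128 * Real.pi) ^ 2) := Real.sqrt_le_sqrt hfin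
    _ = _ := Real.sqrt_sq (by positivity)

/-! ### Cutoff levels and truncated integrals -/

lemma levelInv_apply {h : ℝ → ℝ} (h_anti : StrictAntiOn h (Ioc 0 (1 / 2))) {θ : ℝ}
    (hθ : θ ∈ Ioc (0 : ℝ) (1 / 2)) : levelInv h (h θ) = θ :=
  h_anti.injOn.leftInvOn_invFunOn hθ

lemma IsCutoffLevel.exists_angle {h : ℝ → ℝ} (h_anti : StrictAntiOn h (Ioc 0 (1 / 2))) {n : ℕ}
    {A : ℝ} (hA : IsCutoffLevel h n A) :
    ∃ θ ∈ Ioc (0 : ℝ) (1 / 2), h θ = A ∧ n * θ = A := by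
  obtain ⟨⟨θ, hθ, rfl⟩, hn⟩ := hA
  rw [levelInv_apply h_anti hθ] at hn
  exact ⟨θ, hθ, rfl, hn⟩

/-- In terms of the angle the equation is `h θ = n * θ`, with a strictly decreasing left side and a
nondecreasing right side. -/
lemma IsCutoffLevel.unique {h : ℝ → ℝ} (h_anti : StrictAntiOn h (Ioc 0 (1 / 2))) {n : ℕ}
    {A B : ℝ} (hA : IsCutoffLevel h n A) (hB : IsCutoffLevel h n B) : A = B := by
  obtain ⟨s, hs, rfl, hns⟩ := hA.exists_angle h_anti
  obtain ⟨t, ht, rfl, hnt⟩ := hB.exists_angle h_anti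
  rcases lt_trichotomy s t with hst | rfl | hst
  · have h1 := h_anti hs ht hst
    have h2 := mul_le_mul_of_nonneg_left hst.le (Nat.cast_nonneg (α := ℝ) n)
    linarith
  · rfl
  · have h1 := h_anti ht hs hst
    have h2 := mul_le_mul_of_nonneg_left hst.le (Nat.cast_nonneg (α := ℝ) n)
    linarith

/-- A bounded function has finite integral over a bounded interval, so divergence makes `h`
unbounded, and monotonicity places its large values near `0`. -/
lemma exists_forall_le_of_lintegral_eq_top {h : ℝ → ℝ}
    (h_anti : StrictAntiOn h (Ioc 0 (1 / 2)))
    (h_div : ∫⁻ θ in Ioc (0 : ℝ) (1 / 2), ENNReal.ofReal (h θ) = ⊤) (B : ℝ) :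
    ∃ δ ∈ Ioc (0 : ℝ) (1 / 2), ∀ θ ∈ Ioc 0 δ, B ≤ h θ := by
  by_contra! hcon
  have hB : ∀ θ ∈ Ioc (0 : ℝ) (1 / 2), h θ ≤ B := fun θ hθ => by
    obtain ⟨s, hs, hsB⟩ := hcon θ hθ
    exact (h_anti.antitoneOn ⟨hs.1, hs.2.trans hθ.2⟩ hθ hs.2).trans hsB.le
  have := setLIntegral_mono' (μ := volume) measurableSet_Ioc
    (fun θ hθ => ENNReal.ofReal_le_ofReal (hB θ hθ))
  rw [h_div, setLIntegral_const, top_le_iff] at this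
  exact ENNReal.mul_ne_top ENNReal.ofReal_ne_top (by simp) this

/-- The difference `h θ - n * θ` is nonpositive at `1 / 2` by `hn` and nonnegative at an angle where
`h ≥ n`; the intermediate value theorem gives the cutoff angle. -/
lemma exists_isCutoffLevel {h : ℝ → ℝ} (h_cont : ContinuousOn h (Ioc 0 (1 / 2)))
    (h_anti : StrictAntiOn h (Ioc 0 (1 / 2)))
    (h_div : ∫⁻ θ in Ioc (0 : ℝ) (1 / 2), ENNReal.ofReal (h θ) = ⊤) {n : ℕ}
    (hn : h (1 / 2) ≤ n / 2) : ∃ A, IsCutoffLevel h n A := by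
  obtain ⟨δ, hδ, hδ'⟩ := exists_forall_le_of_lintegral_eq_top h_anti h_div n
  have hsub : Icc δ (1 / 2) ⊆ Ioc 0 (1 / 2) := fun x hx => ⟨hδ.1.trans_le hx.1, hx.2⟩
  have hf : ContinuousOn (fun θ => h θ - n * θ) (Icc δ (1 / 2)) :=
    (h_cont.mono hsub).sub (by fun_prop)
  obtain ⟨θ, hθ, hθ'⟩ := intermediate_value_Icc' hδ.2 hf (show (0 : ℝ) ∈ Icc _ _ by
    refine ⟨by linarith, ?_⟩
    have h1 := hδ' δ (right_mem_Ioc.2 hδ.1)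
    have h2 := mul_le_mul_of_nonneg_left hδ.2 (Nat.cast_nonneg (α := ℝ) n)
    have h3 : (0 : ℝ) ≤ n := Nat.cast_nonneg n
    linarith)
  refine ⟨h θ, mem_image_of_mem h (hsub hθ), ?_⟩
  rw [levelInv_apply h_anti (hsub hθ)]
  simp only at hθ'
  linarith

lemma image_Ioc_eq_Ici {h : ℝ → ℝ} (h_cont : ContinuousOn h (Ioc 0 (1 / 2)))
    (h_anti : StrictAntiOn h (Ioc 0 (1 / 2)))
    (h_div : ∫⁻ θ in Ioc (0 : ℝ) (1 / 2), ENNReal.ofReal (h θ) = ⊤) {a : ℝ}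
    (ha : h (1 / 2) ≤ a) : ∃ θ ∈ Ioc (0 : ℝ) (1 / 2), h θ = a := by
  obtain ⟨δ, hδ, hδ'⟩ := exists_forall_le_of_lintegral_eq_top h_anti h_div a
  have hsub : Icc δ (1 / 2) ⊆ Ioc 0 (1 / 2) := fun x hx => ⟨hδ.1.trans_le hx.1, hx.2⟩
  obtain ⟨θ, hθ, hθ'⟩ := intermediate_value_Icc' hδ.2 (h_cont.mono hsub)
    (show a ∈ Icc _ _ from ⟨ha, hδ' δ (right_mem_Ioc.2 hδ.1)⟩)
  exact ⟨θ, hsub hθ, hθ'⟩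

lemma intervalIntegrable_min {h : ℝ → ℝ} (h_nonneg : ∀ θ ∈ Ioc (0 : ℝ) (1 / 2), 0 ≤ h θ)
    (h_cont : ContinuousOn h (Ioc 0 (1 / 2))) {a : ℝ} (ha : 0 ≤ a) :
    IntervalIntegrable (fun θ => min (h θ) a) volume 0 (1 / 2) := by
  rw [intervalIntegrable_iff_integrableOn_Ioc_of_le (by norm_num)]
  refine Integrable.of_bound
    ((h_cont.inf continuousOn_const).aestronglyMeasurable measurableSet_Ioc) a ?_
  filter_upwards [ae_restrict_mem measurableSet_Ioc] with θ hθ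
  rw [Real.norm_of_nonneg (le_min (h_nonneg θ hθ) ha)]
  exact min_le_right _ _

/-- Monotone convergence. Truncated integrals that are eventually large absorb the additive
constants of both estimates. -/
lemma exists_forall_le_integral_min {h : ℝ → ℝ} (h_nonneg : ∀ θ ∈ Ioc (0 : ℝ) (1 / 2), 0 ≤ h θ)
    (h_cont : ContinuousOn h (Ioc 0 (1 / 2)))
    (h_div : ∫⁻ θ in Ioc (0 : ℝ) (1 / 2), ENNReal.ofReal (h θ) = ⊤) (B : ℝ) :
    ∃ a₀, ∀ a, a₀ ≤ a → B ≤ ∫ θ in (0 : ℝ)..(1 / 2), min (h θ) a := by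
  have hmeas : AEMeasurable h (volume.restrict (Ioc 0 (1 / 2))) :=
    h_cont.aemeasurable measurableSet_Ioc
  have hlim : Tendsto (fun k : ℕ => ∫⁻ θ in Ioc (0 : ℝ) (1 / 2), ENNReal.ofReal (min (h θ) k))
      atTop (𝓝 (∫⁻ θ in Ioc (0 : ℝ) (1 / 2), ENNReal.ofReal (h θ))) := by
    refine lintegral_tendsto_of_tendsto_of_monotone
      (fun k => (hmeas.min aemeasurable_const).ennreal_ofReal)
      (ae_of_all _ fun θ i j hij => ENNReal.ofReal_le_ofReal
        (min_le_min_left _ (by exact_mod_cast hij))) (ae_of_all _ fun θ => ?_)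
    refine tendsto_const_nhds.congr' ?_
    filter_upwards [eventually_ge_atTop ⌈h θ⌉₊] with k hk
    rw [min_eq_left (Nat.ceil_le.1 hk)]
  rw [h_div] at hlim
  obtain ⟨k, hk⟩ := (hlim.eventually (lt_mem_nhds (ENNReal.ofReal_lt_top (r := B)))).exists
  refine ⟨k, fun a ha => ?_⟩
  have hk0 : (0 : ℝ) ≤ k := Nat.cast_nonneg k
  have hi := intervalIntegrable_min h_nonneg h_cont hk0
  have hmono : ∫ θ in (0 : ℝ)..(1 / 2), min (h θ) k ≤ ∫ θ in (0 : ℝ)..(1 / 2), min (h θ) a :=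
    intervalIntegral.integral_mono_on (by norm_num) hi
      (intervalIntegrable_min h_nonneg h_cont (hk0.trans ha)) fun θ _ => min_le_min_left _ ha
  refine le_trans ?_ hmono
  rw [intervalIntegrable_iff_integrableOn_Ioc_of_le (by norm_num)] at hi
  have hnn : 0 ≤ᵐ[volume.restrict (Ioc (0 : ℝ) (1 / 2))] fun θ => min (h θ) k := by
    filter_upwards [ae_restrict_mem measurableSet_Ioc] with θ hθ
    exact le_min (h_nonneg θ hθ) hk0
  rw [← ofReal_integral_eq_lintegral_ofReal hi hnn] at hk
  rw [intervalIntegral.integral_of_le (by norm_num)]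
  exact (ENNReal.ofReal_lt_ofReal_iff'.1 hk).1.le

lemma integral_min_eq {h : ℝ → ℝ} (h_nonneg : ∀ θ ∈ Ioc (0 : ℝ) (1 / 2), 0 ≤ h θ)
    (h_cont : ContinuousOn h (Ioc 0 (1 / 2))) (h_anti : StrictAntiOn h (Ioc 0 (1 / 2))) {θ : ℝ}
    (hθ : θ ∈ Ioc (0 : ℝ) (1 / 2)) :
    ∫ x in (0 : ℝ)..(1 / 2), min (h x) (h θ) = θ * h θ + ∫ x in θ..(1 / 2), h x := by
  have hi := intervalIntegrable_min h_nonneg h_cont (h_nonneg θ hθ)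
  have hi1 := hi.mono_set (c := 0) (d := θ) (by
    rw [uIcc_of_le hθ.1.le, uIcc_of_le (by norm_num)]; exact Icc_subset_Icc_right hθ.2)
  have hi2 := hi.mono_set (c := θ) (d := 1 / 2) (by
    rw [uIcc_of_le hθ.2, uIcc_of_le (by norm_num)]; exact Icc_subset_Icc_left hθ.1.le)
  rw [← intervalIntegral.integral_add_adjacent_intervals hi1 hi2]
  congr 1
  · rw [intervalIntegral.integral_of_le hθ.1.le,
      setIntegral_congr_fun measurableSet_Ioc (g := fun _ => h θ) fun x hx =>
        min_eq_right (h_anti.antitoneOn ⟨hx.1, hx.2.trans hθ.2⟩ hθ hx.2)]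
    simp [hθ.1.le]
  · refine intervalIntegral.integral_congr fun x hx => ?_
    rw [uIcc_of_le hθ.2] at hx
    exact min_eq_left (h_anti.antitoneOn hθ ⟨hθ.1.trans_le hx.1, hx.2⟩ hx.1)

/-- Cutoff angles tend to zero. -/
lemma exists_forall_cutoff_lt {h : ℝ → ℝ} (h_anti : StrictAntiOn h (Ioc 0 (1 / 2)))
    {δ : ℝ} (hδ : δ ∈ Ioc (0 : ℝ) (1 / 2)) :
    ∃ n₀ : ℕ, ∀ n : ℕ, n₀ ≤ n → ∀ θ ∈ Ioc (0 : ℝ) (1 / 2), h θ = n * θ → θ < δ := by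
  refine ⟨⌈h δ / δ⌉₊ + 1, fun n hn θ hθ hnθ => ?_⟩
  by_contra! hcon
  have h1 := h_anti.antitoneOn hδ hθ hcon
  have h2 : h δ / δ < n := (Nat.le_ceil _).trans_lt (by exact_mod_cast hn)
  rw [div_lt_iff₀ hδ.1] at h2
  have h3 := mul_le_mul_of_nonneg_left hcon (Nat.cast_nonneg (α := ℝ) n)
  linarith

/-- If `h⁻¹(a) ≤ 2 r h⁻¹(2 a)` for large `a` with `r < 1`, then the truncated integral of `h` at
level `a` is bounded by a multiple of `a h⁻¹(a)`. -/
lemma exists_integral_min_le_mul {h : ℝ → ℝ} (h_nonneg : ∀ θ ∈ Ioc (0 : ℝ) (1 / 2), 0 ≤ h θ)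
    (h_cont : ContinuousOn h (Ioc 0 (1 / 2))) (h_anti : StrictAntiOn h (Ioc 0 (1 / 2)))
    (h_div : ∫⁻ θ in Ioc (0 : ℝ) (1 / 2), ENNReal.ofReal (h θ) = ⊤)
    (h_lim : limsup (fun a : ℝ => ((levelInv h a / levelInv h (2 * a) : ℝ) : EReal)) atTop < 2) :
    ∃ K a₀ : ℝ, 0 < K ∧ ∀ θ ∈ Ioc (0 : ℝ) (1 / 2), a₀ ≤ h θ →
      ∫ x in (0 : ℝ)..(1 / 2), min (h x) (h θ) ≤ K * (h θ * θ) := by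
  obtain ⟨l, hl1, hl2⟩ := EReal.lt_iff_exists_real_btwn.1 h_lim
  have hl2' : l < 2 := EReal.coe_lt_coe_iff.1 hl2
  obtain ⟨a₁, ha₁⟩ := eventually_atTop.1 (eventually_lt_of_limsup_lt hl1)
  set a₀ := max 1 (max a₁ (h (1 / 2))) with ha₀
  have ha₀1 : 1 ≤ a₀ := le_max_left _ _
  have ha₀2 : a₁ ≤ a₀ := (le_max_left _ _).trans (le_max_right _ _)
  have ha₀3 : h (1 / 2) ≤ a₀ := (le_max_right _ _).trans (le_max_right _ _)
  have hreg : ∀ s ∈ Ioc (0 : ℝ) (1 / 2), ∀ t ∈ Ioc (0 : ℝ) (1 / 2), a₀ ≤ h s → h t = 2 * h s →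
      s ≤ l * t := by
    intro s hs t ht has hts
    have := ha₁ (h s) (ha₀2.trans has)
    rw [← hts, levelInv_apply h_anti hs, levelInv_apply h_anti ht, EReal.coe_lt_coe_iff,
      div_lt_iff₀ ht.1] at this
    exact this.le
  obtain ⟨b, hb, hba⟩ := image_Ioc_eq_Ici h_cont h_anti h_div
    (show h (1 / 2) ≤ 2 * a₀ by linarith)
  set r := l / 2 with hr
  have hr1 : r < 1 := by linarith
  -- The first entry handles levels in `[a₀, 2 a₀]`, whose angles are at least `b`; the second gives
  -- `(K + 1) * r ≤ K`, which closes the induction.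
  set K := max (1 / b) (r / (1 - r)) with hK
  have hb0 : 0 < b := hb.1
  have hK0 : 0 < K := lt_max_of_lt_left (by positivity)
  have hKb : 1 ≤ K * b := by
    rw [← div_le_iff₀ hb0]; exact le_max_left _ _
  have hKr : (K + 1) * r ≤ K := by
    have : r / (1 - r) ≤ K := le_max_right _ _
    rw [div_le_iff₀ (by linarith)] at this
    linarith
  refine ⟨K, a₀, hK0, ?_⟩
  have base : ∀ θ ∈ Ioc (0 : ℝ) (1 / 2), a₀ ≤ h θ → h θ ≤ 2 * a₀ →
      ∫ x in (0 : ℝ)..(1 / 2), min (h x) (h θ) ≤ K * (h θ * θ) := by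
    intro θ hθ h1 h2
    have hbθ : b ≤ θ := by
      by_contra! hcon
      have := h_anti hθ hb hcon
      linarith
    calc ∫ x in (0 : ℝ)..(1 / 2), min (h x) (h θ) ≤ ∫ x in (0 : ℝ)..(1 / 2), h θ :=
          intervalIntegral.integral_mono_on (by norm_num)
            (intervalIntegrable_min h_nonneg h_cont (h_nonneg θ hθ)) (by simp)
            fun x _ => min_le_right _ _
      _ = h θ / 2 := by simp; ring
      _ ≤ h θ * 1 := by linarith
      _ ≤ h θ * (K * θ) := by
          refine mul_le_mul_of_nonneg_left (hKb.trans ?_) (h_nonneg θ hθ)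
          gcongr
      _ = _ := by ring
  -- Induction by halving the level: if `h s = h θ / 2`, the truncated integral grows by at most `s
  -- * h s` from level `h s` to `h θ`, and regularity gives `h s * s ≤ r * (h θ * θ)` with `r < 1`.
  have step : ∀ m : ℕ, ∀ θ ∈ Ioc (0 : ℝ) (1 / 2), a₀ ≤ h θ → h θ ≤ 2 ^ (m + 1) * a₀ →
      ∫ x in (0 : ℝ)..(1 / 2), min (h x) (h θ) ≤ K * (h θ * θ) := by
    intro m
    induction m with
    | zero => intro θ hθ h1 h2; exact base θ hθ h1 (by simpa using h2)
    | succ m ih =>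
      intro θ hθ h1 h2
      rcases le_total (h θ) (2 * a₀) with h3 | h3
      · exact base θ hθ h1 h3
      obtain ⟨s, hs, hsa⟩ := image_Ioc_eq_Ici h_cont h_anti h_div
        (show h (1 / 2) ≤ h θ / 2 by linarith)
      have h4 := ih s hs (by linarith) (by rw [hsa]; rw [pow_succ] at h2; linarith)
      have h5 := hreg s hs θ hθ (by linarith) (by linarith)
      have hi := intervalIntegrable_min h_nonneg h_cont (h_nonneg θ hθ)
      have hi' := intervalIntegrable_min h_nonneg h_cont (h_nonneg s hs)
      have hsub1 : uIcc 0 s ⊆ uIcc (0 : ℝ) (1 / 2) := by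
        rw [uIcc_of_le hs.1.le, uIcc_of_le (by norm_num)]; exact Icc_subset_Icc_right hs.2
      have hsub2 : uIcc s (1 / 2) ⊆ uIcc (0 : ℝ) (1 / 2) := by
        rw [uIcc_of_le hs.2, uIcc_of_le (by norm_num)]; exact Icc_subset_Icc_left hs.1.le
      have e1 : ∫ x in (0 : ℝ)..s, min (h x) (h θ) ≤ s * h θ := by
        calc _ ≤ ∫ x in (0 : ℝ)..s, h θ :=
              intervalIntegral.integral_mono_on hs.1.le (hi.mono_set hsub1) (by simp)
                fun x _ => min_le_right _ _
          _ = s * h θ := by simp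
      have e2 : ∫ x in s..(1 / 2), min (h x) (h θ) = ∫ x in s..(1 / 2), h x := by
        refine intervalIntegral.integral_congr fun x hx => ?_
        rw [uIcc_of_le hs.2] at hx
        refine min_eq_left ?_
        have h6 := h_anti.antitoneOn hs ⟨hs.1.trans_le hx.1, hx.2⟩ hx.1
        linarith
      rw [integral_min_eq h_nonneg h_cont h_anti hs] at h4
      rw [← intervalIntegral.integral_add_adjacent_intervals (hi.mono_set hsub1)
        (hi.mono_set hsub2), e2]
      have h7 : h s * s ≤ r * (h θ * θ) := by
        calc h s * s ≤ h s * (l * θ) := mul_le_mul_of_nonneg_left h5 (h_nonneg s hs)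
          _ = r * (h θ * θ) := by rw [hsa, hr]; ring
      calc _ ≤ s * h θ + (K * (h s * s) - s * h s) := by linarith
        _ = (K + 1) * (h s * s) := by rw [show h θ = 2 * h s by linarith]; ring
        _ ≤ (K + 1) * (r * (h θ * θ)) := by gcongr
        _ = ((K + 1) * r) * (h θ * θ) := by ring
        _ ≤ K * (h θ * θ) := mul_le_mul_of_nonneg_right hKr
          (mul_nonneg (h_nonneg θ hθ) hθ.1.le)
  intro θ hθ h1
  obtain ⟨m, hm⟩ := pow_unbounded_of_one_lt (h θ) (one_lt_two : (1 : ℝ) < 2)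
  refine step m θ hθ h1 (hm.le.trans ?_)
  rw [pow_succ]
  have : (0 : ℝ) < 2 ^ m := by positivity
  nlinarith

/-! ### Uniform constants and bounds for the error of the given measure -/

/-- A comparison which holds for all large `n`, and for each `n` separately, holds uniformly. -/
lemma exists_uniform_bound {Q : ℕ → ℝ → Prop} {F G : ℕ → ℝ → ℝ}
    (hQ : ∀ n A B, Q n A → Q n B → A = B) (hG : ∀ n, 1 ≤ n → ∀ A, Q n A → 0 < G n A) {C₀ : ℝ}
    {n₀ : ℕ} (hev : ∀ n, n₀ ≤ n → 1 ≤ n → ∀ A, Q n A → F n A ≤ C₀ * G n A) :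
    ∃ C, 0 < C ∧ ∀ n, 1 ≤ n → ∀ A, Q n A → F n A ≤ C * G n A := by
  -- For a single `n` at most one `A` occurs and `G n A > 0`, so the ratio itself serves as
  -- constant; the finitely many `n < n₀` are absorbed by a sum.
  have hpt : ∀ n, ∃ C, 0 ≤ C ∧ (1 ≤ n → ∀ A, Q n A → F n A ≤ C * G n A) := by
    intro n
    by_cases h : ∃ A, Q n A
    · obtain ⟨A, hA⟩ := h
      refine ⟨max 0 (F n A / G n A), le_max_left _ _, fun hn B hB => ?_⟩
      obtain rfl := hQ n A B hA hB
      rw [← div_le_iff₀ (hG n hn A hA)]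
      exact le_max_right _ _
    · exact ⟨0, le_rfl, fun _ A hA => absurd ⟨A, hA⟩ h⟩
  choose D hD0 hD using hpt
  have hs : 0 ≤ ∑ n ∈ Finset.range n₀, D n := Finset.sum_nonneg fun n _ => hD0 n
  refine ⟨max 1 C₀ + ∑ n ∈ Finset.range n₀, D n, by positivity, fun n hn A hA => ?_⟩
  have hG' := (hG n hn A hA).le
  rcases le_or_gt n₀ n with h | h
  · refine (hev n h hn A hA).trans (mul_le_mul_of_nonneg_right ?_ hG')
    linarith [le_max_right 1 C₀]
  · refine (hD n hn A hA).trans (mul_le_mul_of_nonneg_right ?_ hG')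
    have := Finset.single_le_sum (fun n _ => hD0 n) (Finset.mem_range.2 h)
    linarith [le_max_left 1 C₀]

/-- The competitor `X ^ n` has squared norm equal to the total mass, which is less than `1`. Thus
`log e_n` is strictly negative, as needed to absorb small `n`. -/
lemma szegoError_deepZeroMeasure_lt_one {h : ℝ → ℝ}
    (h_nonneg : ∀ θ ∈ Ioc (0 : ℝ) (1 / 2), 0 ≤ h θ)
    (h_cont : ContinuousOn h (Ioc 0 (1 / 2))) (h_anti : StrictAntiOn h (Ioc 0 (1 / 2))) (n : ℕ) :
    szegoError (deepZeroMeasure h) n < 1 := by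
  have h1 := szegoError_le_sqrt_integral (deepZeroMeasure h) (Polynomial.monic_X_pow (R := ℂ) n)
  rw [Polynomial.natDegree_X_pow] at h1
  refine h1.trans_lt ?_
  rw [Real.sqrt_lt' one_pos, integral_deepZeroMeasure h_cont]
  have hi : IntervalIntegrable (fun t => Real.exp (-h t)) volume 0 (1 / 2) := by
    rw [intervalIntegrable_iff_integrableOn_Ioc_of_le (by norm_num)]
    refine Integrable.of_bound
      ((Real.continuous_exp.comp_continuousOn h_cont.neg).aestronglyMeasurable measurableSet_Ioc)
      1 ?_
    filter_upwards [ae_restrict_mem measurableSet_Ioc] with θ hθ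
    rw [Real.norm_eq_abs, Real.abs_exp, Real.exp_le_one_iff]
    linarith [h_nonneg θ hθ]
  have h2 : ∫ x : UnitAddCircle, Real.exp (-h ‖x‖) *
      ‖(Polynomial.X ^ n : Polynomial ℂ).eval (AddCircle.toCircle x : ℂ)‖ ^ 2 =
        2 * ∫ t in (0 : ℝ)..(1 / 2), Real.exp (-h t) := by
    rw [← UnitAddCircle.integral_comp_norm _ hi]
    simp only [Polynomial.eval_pow, Polynomial.eval_X, norm_pow, Circle.norm_coe, one_pow, mul_one]
  have h3 : 0 < ∫ t in (0 : ℝ)..(1 / 2), (1 - Real.exp (-h t)) := by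
    have h1i : IntervalIntegrable (fun _ => (1 : ℝ)) volume 0 (1 / 2) := by simp
    refine intervalIntegral.intervalIntegral_pos_of_pos_on (h1i.sub hi) (fun t ht => ?_)
      (by norm_num)
    have h4 := h_anti (Ioo_subset_Ioc_self ht) (right_mem_Ioc.2 (by norm_num)) ht.2
    have h5 := h_nonneg (1 / 2) (right_mem_Ioc.2 (by norm_num))
    rw [sub_pos, Real.exp_lt_one_iff]
    linarith
  rw [intervalIntegral.integral_sub (by simp) hi] at h3
  simp only [intervalIntegral.integral_const, smul_eq_mul] at h3
  rw [h2]
  linarith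

/-- Besides its use at the cutoff angle, the choice `θ = 1 / 12` shows `e_n > 0` for every `n ≥ 1`.
-/
lemma exp_le_szegoError_deepZeroMeasure {h : ℝ → ℝ}
    (h_nonneg : ∀ θ ∈ Ioc (0 : ℝ) (1 / 2), 0 ≤ h θ)
    (h_cont : ContinuousOn h (Ioc 0 (1 / 2))) (h_anti : StrictAntiOn h (Ioc 0 (1 / 2)))
    {n : ℕ} (hn : 1 ≤ n) {θ : ℝ} (hθ : 0 < θ) (hθ' : θ ≤ 1 / 12) :
    Real.exp (-(80 * n * θ ^ 2 + θ * h θ + (∫ x in θ..(1 / 2), h x) + 5 / 2)) ≤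
      szegoError (deepZeroMeasure h) n := by
  refine le_szegoError fun P hP hPn => ?_
  obtain ⟨h1, h2⟩ := hP.le_log_integral_deepZeroMeasure h_nonneg h_cont h_anti hPn hn hθ hθ'
  refine Real.le_sqrt_of_sq_le ?_
  rw [← Real.exp_nat_mul]
  refine le_trans (Real.exp_le_exp.2 (le_trans (le_of_eq ?_) h2)) (Real.exp_log h1).le
  push_cast
  ring

/-! ### Construction of the minorant -/

/-- Under either regularity condition `h` has a minorant of comparable integral to which the
upper bound for the Szegő error applies. -/
lemma exists_minorant {h : ℝ → ℝ} (h_nonneg : ∀ θ ∈ Ioc (0 : ℝ) (1 / 2), 0 ≤ h θ)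
    (h_cont : ContinuousOn h (Ioc 0 (1 / 2))) (h_anti : StrictAntiOn h (Ioc 0 (1 / 2)))
    (h_div : ∫⁻ θ in Ioc (0 : ℝ) (1 / 2), ENNReal.ofReal (h θ) = ⊤)
    (h_reg : MonotoneOn (fun θ : ℝ => θ ^ 2 * h θ) (Ioc 0 (1 / 2)) ∨
      limsup (fun a : ℝ => ((levelInv h a / levelInv h (2 * a) : ℝ) : EReal)) atTop < 2) :
    ∃ K a₀ : ℝ, 0 < K ∧ ∀ θ ∈ Ioc (0 : ℝ) (1 / 2), a₀ ≤ h θ →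
      ∃ g : UnitAddCircle → ℝ, AEMeasurable g ∧ (∀ x, 0 ≤ g x) ∧ (∀ x, g x ≤ h θ / 10) ∧
        (∀ x y : UnitAddCircle, θ < ‖x‖ → ‖x‖ / 2 < ‖y‖ → 2 * g y ≤ h ‖x‖) ∧
        ∫ t in (0 : ℝ)..(1 / 2), min (h t) (h θ) ≤ K * ∫ x, g x := by
  rcases h_reg with hmono | hlim
  · refine ⟨5, 0, by norm_num, fun θ hθ _ => ?_⟩
    -- The maximum with `0` matters only at `t = 0`, where `h` is unconstrained. The factor `1 / 10`
    -- gives `g ≤ h θ / 10`, and `h (t / 2) ≤ 4 h t` gives `2 g y ≤ (4 / 5) h ‖x‖`. Both halves of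
    -- the circle contribute, hence `K = 5`.
    set f : ℝ → ℝ := fun t => max 0 (min (h t) (h θ)) / 10 with hf
    have hfeq : ∀ t ∈ Ioc (0 : ℝ) (1 / 2), f t = min (h t) (h θ) / 10 := fun t ht => by
      simp only [hf]
      rw [max_eq_right (le_min (h_nonneg t ht) (h_nonneg θ hθ))]
    have hi := (intervalIntegrable_min h_nonneg h_cont (h_nonneg θ hθ)).div_const 10
    have hfi : IntervalIntegrable f volume 0 (1 / 2) := hi.congr fun t ht => by
      rw [uIoc_of_le (by norm_num)] at ht
      exact (hfeq t ht).symm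
    refine ⟨fun x => f ‖x‖, ?_, fun x => by positivity, fun x => ?_, fun x y hx hxy => ?_, ?_⟩
    · refine UnitAddCircle.aemeasurable_comp_norm ?_
      exact (continuousOn_const.sup (h_cont.inf continuousOn_const)).div_const _
    · simp only [hf]
      gcongr
      exact max_le (h_nonneg θ hθ) (min_le_right _ _)
    · have hx0 : 0 < ‖x‖ := hθ.1.trans hx
      have hxm : ‖x‖ ∈ Ioc (0 : ℝ) (1 / 2) := ⟨hx0, x.norm_le_half⟩
      have hym : ‖y‖ ∈ Ioc (0 : ℝ) (1 / 2) := ⟨by linarith, y.norm_le_half⟩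
      have hx2 : ‖x‖ / 2 ∈ Ioc (0 : ℝ) (1 / 2) := ⟨by linarith, by linarith [hxm.2]⟩
      have h1 := h_anti hx2 hym hxy
      have h2 := hmono hx2 hxm (by linarith)
      simp only at h2
      have h3 : h (‖x‖ / 2) ≤ 4 * h ‖x‖ := by
        have : ‖x‖ ^ 2 * h (‖x‖ / 2) ≤ ‖x‖ ^ 2 * (4 * h ‖x‖) := by linarith
        exact le_of_mul_le_mul_left this (by positivity)
      simp only [hfeq _ hym]
      have h4 := min_le_left (h ‖y‖) (h θ)
      have h5 := h_nonneg _ hxm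
      linarith
    · rw [UnitAddCircle.integral_comp_norm _ hfi, intervalIntegral.integral_of_le (by norm_num),
        intervalIntegral.integral_of_le (by norm_num),
        setIntegral_congr_fun measurableSet_Ioc hfeq, integral_div]
      linarith
  · obtain ⟨K, a₀, hK, hKa⟩ := exists_integral_min_le_mul h_nonneg h_cont h_anti h_div hlim
    refine ⟨10 * K, a₀, by positivity, fun θ hθ hθa => ?_⟩
    have hA := h_nonneg θ hθ
    -- The ball of radius `θ / 2` has measure `θ` and contains no `y` with `‖y‖ > ‖x‖ / 2 > θ / 2`,
    -- so the slow variation condition reduces to `0 ≤ h ‖x‖`.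
    refine ⟨(Metric.closedBall 0 (θ / 2)).indicator fun _ => h θ / 10,
      (measurable_const.indicator measurableSet_closedBall).aemeasurable,
      fun x => indicator_nonneg (fun _ _ => by positivity) _,
      fun x => indicator_le_self' (fun _ _ => by positivity) _, fun x y hx hxy => ?_, ?_⟩
    · rw [indicator_of_notMem]
      · simpa using h_nonneg _ ⟨hθ.1.trans hx, x.norm_le_half⟩
      · rw [mem_closedBall_zero_iff]
        linarith
    · refine (hKa θ hθ hθa).trans_eq ?_
      rw [integral_indicator measurableSet_closedBall, setIntegral_const, measureReal_def,
        AddCircle.volume_closedBall, min_eq_right (by linarith [hθ.2]),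
        ENNReal.toReal_ofReal (by linarith [hθ.1]), smul_eq_mul]
      ring

/-! ### The two-sided estimate -/

theorem mainTheorem1 (h : ℝ → ℝ)
    (h_nonneg : ∀ θ ∈ Ioc (0 : ℝ) (1 / 2), 0 ≤ h θ)
    (h_cont : ContinuousOn h (Ioc 0 (1 / 2)))
    (h_anti : StrictAntiOn h (Ioc 0 (1 / 2)))
    (h_div : ∫⁻ θ in Ioc (0 : ℝ) (1 / 2), ENNReal.ofReal (h θ) = ⊤)
    (h_reg :
      (MonotoneOn (fun θ : ℝ => θ ^ 2 * h θ) (Ioc 0 (1 / 2)) ∧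
        (fun θ : ℝ => |Real.log θ|) =O[𝓝[>] 0] h) ∨
      limsup (fun a : ℝ => ((levelInv h a / levelInv h (2 * a) : ℝ) : EReal)) atTop < 2) :
    (∀ n : ℕ, 1 ≤ n → h (1 / 2) ≤ n / 2 → ∃! A : ℝ, IsCutoffLevel h n A) ∧
    ∃ c C : ℝ, 0 < c ∧ 0 < C ∧
      ∀ n : ℕ, 1 ≤ n → ∀ A : ℝ, IsCutoffLevel h n A →
        c * (∫ θ in (0 : ℝ)..(1 / 2), min (h θ) A) ≤
            |Real.log (szegoError (deepZeroMeasure h) n)| ∧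
          |Real.log (szegoError (deepZeroMeasure h) n)| ≤
            C * ∫ θ in (0 : ℝ)..(1 / 2), min (h θ) A := by
  refine ⟨fun n _ hn => ?_, ?_⟩
  · obtain ⟨A, hA⟩ := exists_isCutoffLevel h_cont h_anti h_div hn
    exact ⟨A, hA, fun B hB => hB.unique h_anti hA⟩
  have huniq : ∀ n A B, IsCutoffLevel h n A → IsCutoffLevel h n B → A = B :=
    fun n A B hA hB => hA.unique h_anti hB
  set e : ℕ → ℝ := fun n => szegoError (deepZeroMeasure h) n with he
  have he0 : ∀ n, 1 ≤ n → 0 < e n := fun n hn => (Real.exp_pos _).trans_le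
    (exp_le_szegoError_deepZeroMeasure h_nonneg h_cont h_anti hn (by norm_num) le_rfl)
  have he1 : ∀ n, e n < 1 := szegoError_deepZeroMeasure_lt_one h_nonneg h_cont h_anti
  have habs : ∀ n, 1 ≤ n → |Real.log (e n)| = -Real.log (e n) := fun n hn =>
    abs_of_neg (Real.log_neg (he0 n hn) (he1 n))
  have hlogpos : ∀ n, 1 ≤ n → ∀ A, IsCutoffLevel h n A → 0 < |Real.log (e n)| :=
    fun n hn A _ => abs_pos.2 (Real.log_neg (he0 n hn) (he1 n)).ne
  set H : ℝ → ℝ := fun A => ∫ θ in (0 : ℝ)..(1 / 2), min (h θ) A with hH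
  have hHpos : ∀ n : ℕ, 1 ≤ n → ∀ A, IsCutoffLevel h n A → 0 < H A := by
    intro n hn A hA
    obtain ⟨s, hs, -, hsA⟩ := hA.exists_angle h_anti
    have hA0 : 0 < A := hsA ▸ mul_pos (by exact_mod_cast hn) hs.1
    refine intervalIntegral.intervalIntegral_pos_of_pos_on
      (intervalIntegrable_min h_nonneg h_cont hA0.le) (fun t ht => lt_min ?_ hA0) (by norm_num)
    have h4 := h_anti (Ioo_subset_Ioc_self ht) (right_mem_Ioc.2 (by norm_num)) ht.2
    exact (h_nonneg (1 / 2) (right_mem_Ioc.2 (by norm_num))).trans_lt h4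
  have hlarge : ∀ B₁ B₂ : ℝ, ∃ n₀ : ℕ, ∀ n, n₀ ≤ n → ∀ A, IsCutoffLevel h n A →
      ∃ θ ∈ Ioc (0 : ℝ) (1 / 2), θ ≤ 1 / 12 ∧ h θ = A ∧ n * θ = A ∧ B₁ ≤ A ∧ B₂ ≤ H A := by
    intro B₁ B₂
    obtain ⟨a₀, ha₀⟩ := exists_forall_le_integral_min h_nonneg h_cont h_div B₂
    obtain ⟨δ, hδ, hδ'⟩ := exists_forall_le_of_lintegral_eq_top h_anti h_div (max B₁ a₀)
    obtain ⟨n₀, hn₀⟩ := exists_forall_cutoff_lt h_anti (δ := min δ (1 / 12))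
      ⟨lt_min hδ.1 (by norm_num), (min_le_left _ _).trans hδ.2⟩
    refine ⟨n₀, fun n hn A hA => ?_⟩
    obtain ⟨s, hs, rfl, hns⟩ := hA.exists_angle h_anti
    have hsδ := hn₀ n hn s hs hns.symm
    have hb := hδ' s ⟨hs.1, hsδ.le.trans (min_le_left _ _)⟩
    exact ⟨s, hs, hsδ.le.trans (min_le_right _ _), rfl, hns, (le_max_left _ _).trans hb,
      ha₀ _ ((le_max_right _ _).trans hb)⟩
  obtain ⟨C, hC, hCn⟩ : ∃ C, 0 < C ∧ ∀ n, 1 ≤ n → ∀ A, IsCutoffLevel h n A →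
      |Real.log (e n)| ≤ C * H A := by
    obtain ⟨n₀, hn₀⟩ := hlarge 0 1
    -- With `n * s = h s = A` the lower bound for `e n` costs `80 s A + H + 5 / 2`; since `s A ≤ H`
    -- and `H ≥ 1`, this is at most `84 H`.
    refine exists_uniform_bound (C₀ := 84) (n₀ := n₀) huniq hHpos fun n hn hn1 A hA => ?_
    obtain ⟨s, hs, hs', rfl, hns, -, hB⟩ := hn₀ n hn A hA
    have h1 := exp_le_szegoError_deepZeroMeasure h_nonneg h_cont h_anti hn1 hs.1 hs'
    have h2 := (Real.le_log_iff_exp_le (he0 n hn1)).2 h1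
    have h3 : H (h s) = s * h s + ∫ x in s..(1 / 2), h x :=
      integral_min_eq h_nonneg h_cont h_anti hs
    have h4 : 0 ≤ ∫ x in s..(1 / 2), h x :=
      intervalIntegral.integral_nonneg hs.2 fun x hx => h_nonneg x ⟨hs.1.trans_le hx.1, hx.2⟩
    rw [show 80 * (n : ℝ) * s ^ 2 = 80 * (s * (n * s)) by ring, hns] at h2
    rw [habs n hn1]
    linarith
  obtain ⟨D, hD, hDn⟩ : ∃ D, 0 < D ∧ ∀ n, 1 ≤ n → ∀ A, IsCutoffLevel h n A →
      H A ≤ D * |Real.log (e n)| := by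
    obtain ⟨K, a₀, hK, hKa⟩ :=
      exists_minorant h_nonneg h_cont h_anti h_div (h_reg.imp_left And.left)
    set L := Real.log (1 + 128 * Real.pi) with hL
    have hπ := Real.pi_pos
    -- The level `10` is the requirement `10 ≤ n * θ` of the kernel construction. Since `H ≤ K L + K
    -- |log e_n|`, the bound `H ≥ 2 K L` absorbs `K L` and leaves `H ≤ 2 K |log e_n|`.
    obtain ⟨n₀, hn₀⟩ := hlarge (max 10 a₀) (2 * K * L)
    refine exists_uniform_bound (F := fun _ A => H A) (G := fun n _ => |Real.log (e n)|)
      (C₀ := 2 * K) (n₀ := n₀) huniq hlogpos fun n hn hn1 A hA => ?_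
    obtain ⟨s, hs, -, rfl, hns, hA1, hB⟩ := hn₀ n hn A hA
    obtain ⟨g, hgm, hg0, hga, hgh, hgi⟩ := hKa s hs ((le_max_right _ _).trans hA1)
    have h1 := szegoError_le_mul_exp_neg_integral h_nonneg h_cont h_anti hs.1 hs.2
      (hns ▸ (le_max_left _ _).trans hA1) hgm hg0 hga (by rw [hns])
      (by linarith [h_nonneg s hs]) hgh
    have h2 := Real.log_le_log (he0 n hn1) h1
    rw [Real.log_mul (by positivity) (Real.exp_pos _).ne', Real.log_exp, ← hL] at h2
    rw [habs n hn1]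
    have h3 : H (h s) ≤ K * ∫ x, g x := hgi
    have h4 : K * (∫ x, g x) ≤ K * (L - Real.log (e n)) := by
      gcongr
      linarith
    linarith
  refine ⟨D⁻¹, C, inv_pos.2 hD, hC, fun n hn A hA => ⟨?_, hCn n hn A hA⟩⟩
  rw [inv_mul_le_iff₀ hD]
  exact hDn n hn A hA
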